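/- Let $k$ be a field; algebras are over $k$, associative and unital, and $\otimes=\otimes_k$. **Quasi-bialgebras.** Let $H$ be a quasi-bialgebra: an algebra with algebra maps $\Delta:H\to H\otimes H$, $\Delta(h)=h_1\otimes h_2$, and $\varepsilon:H\to k$, and an invertible $\Phi\in H\otimes H\otimes H$ such that $(\mathrm{id}\otimes\Delta)(\Delta(h))\,\Phi=\Phi\,(\Delta\otimes\mathrm{id})(\Delta(h))$ and $(\varepsilon\otimes\mathrm{id})\Delta(h)=h=(\mathrm{id}\otimes\varepsilon)\Delta(h)$ for all $h\in H$, $(1\otimes\Phi)(\mathrm{id}\otimes\Delta\otimes\mathrm{id})(\Phi)(\Phi\otimes1)=(\mathrm{id}\otimes\mathrm{id}\otimes\Delta)(\Phi)(\Delta\otimes\mathrm{id}\otimes\mathrm{id})(\Phi)$ and $(\mathrm{id}\otimes\varepsilon\otimes\mathrm{id})(\Phi)=1\otimes1$. Write $\Phi^{-1}=x^1\otimes x^2\otimes x^3$. Let $F=F^1\otimes F^2\in H\otimes H$ be a gauge transformation, i.e. invertible with $(\varepsilon\otimes\mathrm{id})(F)=(\mathrm{id}\otimes\varepsilon)(F)=1$,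 and write $F^{-1}=G^1\otimes G^2$. Let $H_F$ be the algebra $H$ with counit $\varepsilon$ and $$\Delta_F(h)=F\Delta(h)F^{-1},\qquad \Phi_F=(1\otimes F)(\mathrm{id}\otimes\Delta)(F)\,\Phi\,(\Delta\otimes\mathrm{id})(F^{-1})(F^{-1}\otimes1).$$ **Module algebras.** Let $B$ be a right $H$-module algebra: a right $H$-module with a bilinear multiplication that has a unit $1_B$, such that $(bb')\cdot h=(b\cdot h_1)(b'\cdot h_2)$, $1_B\cdot h=\varepsilon(h)1_B$ and $(bb')b''=(b\cdot x^1)\big((b'\cdot x^2)(b''\cdot x^3)\big)$. Let ${}_FB$ be the module $B$ with the same unit and the multiplication $b*b'=(b\cdot F^1)(b'\cdot F^2)$. The smash product $H\#B$ is the space $H\otimes B$ with unit $1\#1_B$ and multiplication $$(h\#b)(h'\#b')=hh'_1x^1\#(b\cdot h'_2x^2)(b'\cdot x^3);$$ $H_F\#{}_FB$ is defined by the same formula for $H_F$ and ${}_FB$. **Crossed products.** Let $A$ be an algebra with multiplication $\mu$, $V$ a vector space with a distinguished element $1_V$, and $R:V\otimes A\to A\otimes V$, $\sigma:V\otimes V\to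 A\otimes V$ linear maps. For a linear map $f:V\otimes X\to A\otimes V$ put $\hat f=(\mu\otimes\mathrm{id})(\mathrm{id}_A\otimes f):A\otimes V\otimes X\to A\otimes V$, and for $f:V\to A\otimes V$ put $\hat f=(\mu\otimes\mathrm{id})(\mathrm{id}_A\otimes f):A\otimes V\to A\otimes V$. One says that $A\otimes_{R,\sigma}V$ is a crossed product if $R(1_V\otimes a)=a\otimes1_V$, $R(v\otimes1_A)=1_A\otimes v$, $\sigma(1_V\otimes v)=\sigma(v\otimes1_V)=1_A\otimes v$ for all $a\in A$, $v\in V$, and $$R(\mathrm{id}\otimes\mu)=\hat R(R\otimes\mathrm{id}),\qquad \hat\sigma(R\otimes\mathrm{id})(\mathrm{id}\otimes\sigma)=\hat\sigma(\sigma\otimes\mathrm{id}),\qquad \hat\sigma(R\otimes\mathrm{id})(\mathrm{id}\otimes R)=\hat R(\sigma\otimes\mathrm{id}).$$ Its multiplication is $m_{R,\sigma}=\hat\sigma(\hat R\otimes\mathrm{id})$ on $(A\otimes V)\otimes(A\otimes V)$. For linear maps $\theta,\gamma:V\to A\otimes V$ put $R'=\hat\gamma\,\hat R\,(\theta\otimes\mathrm{id})$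 and $\sigma'=\hat\gamma\, m_{R,\sigma}(\theta\otimes\theta)$. The *twisting conditions* for $(\theta,\gamma)$ are: $\theta(1_V)=\gamma(1_V)=1_A\otimes1_V$; $\hat\gamma(\theta(v))=1_A\otimes v=\hat\theta(\gamma(v))$ for all $v\in V$; and $\widehat{\sigma'}\,(\hat\gamma R\otimes\mathrm{id})(\mathrm{id}\otimes\gamma)=\hat\gamma\,\sigma$. **Proposition.** With $H$, $F$, $B$ as above: 1. $H_F$ is a quasi-bialgebra and ${}_FB$ is a right $H_F$-module algebra, with the same unit and action as $B$. 2. $H\#B$ is the crossed product $H\otimes_{R,\sigma}B$ (with the same multiplication and distinguished element $1_B$), where $R(b\otimes h)=h_1\otimes b\cdot h_2$ and $\sigma(b\otimes b')=x^1\otimes(b\cdot x^2)(b'\cdot x^3)$. Likewise $H_F\#{}_FB$ is the crossed product $H\otimes_{R_F,\sigma_F}B$, where $R_F,\sigma_F$ are given by the same formulas for $H_F$ and ${}_FB$. 3. The maps $\theta(b)=F^1\otimes b\cdot F^2$ and $\gamma(b)=G^1\otimes b\cdot G^2$ satisfy the twisting conditions for $H\otimes_{R,\sigma}B$, and $R'=R_F$,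 $\sigma'=\sigma_F$. 4. $H\#B$ and $H_F\#{}_FB$ are associative algebras with unit $1\#1_B$, and there is an algebra isomorphism $$H_F\#{}_FB\;\cong\;H\#B,\qquad h\#b\mapsto hF^1\#b\cdot F^2,$$ which is the map $\hat\theta:h\otimes b\mapsto h\,\theta(b)$. -/

import Mathlib

open scoped TensorProduct

noncomputable section

namespace QuasiSmash

/-! ### Associative unital algebra structures on a vector space -/

section AlgebraStructures

variable {k M : Type*} [Field k] [AddCommGroup M] [Module k M]

/-- A bilinear multiplication `mul` and an element `one` of a vector space `M` make `M` an
associative unital `k`-algebra. -/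
structure IsAlgebraStructure (mul : M →ₗ[k] M →ₗ[k] M) (one : M) : Prop where
  mul_assoc : ∀ x y z, mul (mul x y) z = mul x (mul y z)
  one_mul : ∀ x, mul one x = x
  mul_one : ∀ x, mul x one = x

/-- The vector space `M` regarded as the `k`-algebra with multiplication `mul` and unit `one`. -/
def AlgebraOf {mul : M →ₗ[k] M →ₗ[k] M} {one : M} (_h : IsAlgebraStructure mul one) : Type _ := M

namespace AlgebraOf

variable {mul : M →ₗ[k] M →ₗ[k] M} {one : M} (h : IsAlgebraStructure mul one)

instance : AddCommGroup (AlgebraOf h) := inferInstanceAs (AddCommGroup M)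

instance : Module k (AlgebraOf h) := inferInstanceAs (Module k M)

/-- The identity map from the vector space `M` to the algebra `(M, mul, one)`. -/
def of : M ≃ₗ[k] AlgebraOf h := LinearEquiv.refl k M

instance : Ring (AlgebraOf h) where
  __ := (inferInstance : AddCommGroup (AlgebraOf h))
  mul x y := of h (mul ((of h).symm x) ((of h).symm y))
  one := of h one
  left_distrib x y z := (mul x).map_add y z
  right_distrib x y z := LinearMap.map_add₂ mul x y z
  zero_mul x := LinearMap.map_zero₂ mul x
  mul_zero x := (mul x).map_zero
  mul_assoc := h.mul_assoc
  one_mul := h.one_mul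
  mul_one := h.mul_one

instance : Algebra k (AlgebraOf h) :=
  Algebra.ofModule (fun r x y => LinearMap.map_smul₂ mul r x y) (fun r x y => (mul x).map_smul r y)

theorem of_mul_of (x y : M) : of h x * of h y = of h (mul x y) := rfl

theorem one_eq_of : (1 : AlgebraOf h) = of h one := rfl

end AlgebraOf

end AlgebraStructures

/-! ### Crossed products of an algebra with a vector space -/

section CrossedProducts

variable (k : Type*) {A V X : Type*} [Field k] [Ring A] [Algebra k A]
  [AddCommGroup V] [Module k V] [AddCommGroup X] [Module k X]

variable (A V) in
/-- `μ ⊗ id : A ⊗ A ⊗ V → A ⊗ V`. -/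
def mulId : A ⊗[k] (A ⊗[k] V) →ₗ[k] A ⊗[k] V :=
  (LinearMap.mul' k A).rTensor V ∘ₗ (TensorProduct.assoc k A A V).symm.toLinearMap

variable {k}

/-- For `f : V → A ⊗ V` the map `(μ ⊗ id) ∘ (id ⊗ f) : A ⊗ V → A ⊗ V`, `a ⊗ v ↦ a f(v)`. -/
def ext₁ (f : V →ₗ[k] A ⊗[k] V) : A ⊗[k] V →ₗ[k] A ⊗[k] V :=
  mulId k A V ∘ₗ f.lTensor A

/-- For `f : V ⊗ X → A ⊗ V` the map `(μ ⊗ id) ∘ (id ⊗ f) : (A ⊗ V) ⊗ X → A ⊗ V`,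
`a ⊗ v ⊗ x ↦ a f(v ⊗ x)`. -/
def ext₂ (f : V ⊗[k] X →ₗ[k] A ⊗[k] V) : (A ⊗[k] V) ⊗[k] X →ₗ[k] A ⊗[k] V :=
  mulId k A V ∘ₗ f.lTensor A ∘ₗ (TensorProduct.assoc k A V X).toLinearMap

/-- The conditions on `R : V ⊗ A → A ⊗ V` and `σ : V ⊗ V → A ⊗ V` under which
`A ⊗_{R, σ} V` is a crossed product, where `e` is the distinguished element of `V`. -/
structure IsCrossedProduct (e : V) (R : V ⊗[k] A →ₗ[k] A ⊗[k] V)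
    (σ : V ⊗[k] V →ₗ[k] A ⊗[k] V) : Prop where
  R_one_left : ∀ a : A, R (e ⊗ₜ a) = a ⊗ₜ e
  R_one_right : ∀ v : V, R (v ⊗ₜ 1) = 1 ⊗ₜ v
  σ_one_left : ∀ v : V, σ (e ⊗ₜ v) = 1 ⊗ₜ v
  σ_one_right : ∀ v : V, σ (v ⊗ₜ e) = 1 ⊗ₜ v
  R_mul : R ∘ₗ (LinearMap.mul' k A).lTensor V =
    ext₂ R ∘ₗ R.rTensor A ∘ₗ (TensorProduct.assoc k V A A).symm.toLinearMap
  σ_cocycle :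
    ext₂ σ ∘ₗ R.rTensor V ∘ₗ (TensorProduct.assoc k V A V).symm.toLinearMap ∘ₗ σ.lTensor V =
      ext₂ σ ∘ₗ σ.rTensor V ∘ₗ (TensorProduct.assoc k V V V).symm.toLinearMap
  twisted_module :
    ext₂ σ ∘ₗ R.rTensor V ∘ₗ (TensorProduct.assoc k V A V).symm.toLinearMap ∘ₗ R.lTensor V =
      ext₂ R ∘ₗ σ.rTensor A ∘ₗ (TensorProduct.assoc k V V A).symm.toLinearMap

/-- The multiplication of `A ⊗_{R, σ} V`, as a map on `(A ⊗ V) ⊗ (A ⊗ V)`: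
`(a ⊗ v)(a' ⊗ v') = a a'_R σ₁(v_R, v') ⊗ σ₂(v_R, v')`. -/
def crossedMulMap (R : V ⊗[k] A →ₗ[k] A ⊗[k] V) (σ : V ⊗[k] V →ₗ[k] A ⊗[k] V) :
    (A ⊗[k] V) ⊗[k] (A ⊗[k] V) →ₗ[k] A ⊗[k] V :=
  ext₂ σ ∘ₗ (ext₂ R).rTensor V ∘ₗ (TensorProduct.assoc k (A ⊗[k] V) A V).symm.toLinearMap

/-- The multiplication of `A ⊗_{R, σ} V`, as a bilinear map. -/
def crossedMul (R : V ⊗[k] A →ₗ[k] A ⊗[k] V) (σ : V ⊗[k] V →ₗ[k] A ⊗[k] V) :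
    A ⊗[k] V →ₗ[k] A ⊗[k] V →ₗ[k] A ⊗[k] V :=
  TensorProduct.curry (crossedMulMap R σ)

/-- The map `R'(v ⊗ a) = v_{<-1>} a_R v_{<0>R{-1}} ⊗ v_{<0>R{0}}` built from `R`,
`θ(v) = v_{<-1>} ⊗ v_{<0>}` and `γ(v) = v_{{-1}} ⊗ v_{{0}}`. -/
def twistedR (R : V ⊗[k] A →ₗ[k] A ⊗[k] V) (θ γ : V →ₗ[k] A ⊗[k] V) :
    V ⊗[k] A →ₗ[k] A ⊗[k] V :=
  ext₁ γ ∘ₗ ext₂ R ∘ₗ θ.rTensor A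

/-- The map `σ'`: multiply `θ(v)` and `θ(w)` in `A ⊗_{R, σ} V`, then apply
`a ⊗ u ↦ a γ(u)`. -/
def twistedσ (R : V ⊗[k] A →ₗ[k] A ⊗[k] V) (σ : V ⊗[k] V →ₗ[k] A ⊗[k] V)
    (θ γ : V →ₗ[k] A ⊗[k] V) : V ⊗[k] V →ₗ[k] A ⊗[k] V :=
  ext₁ γ ∘ₗ crossedMulMap R σ ∘ₗ TensorProduct.map θ θ

/-- The conditions on `θ` and `γ`, for a crossed product `A ⊗_{R, σ} V`, in the theorem of
invariance under twisting. Note that `ext₁ θ` is `a ⊗ v ↦ a v_{<-1>} ⊗ v_{<0>}` and `ext₁ γ` is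
`a ⊗ v ↦ a v_{{-1}} ⊗ v_{{0}}`. -/
structure IsTwistingPair (e : V) (R : V ⊗[k] A →ₗ[k] A ⊗[k] V)
    (σ : V ⊗[k] V →ₗ[k] A ⊗[k] V) (θ γ : V →ₗ[k] A ⊗[k] V) : Prop where
  θ_one : θ e = 1 ⊗ₜ e
  γ_one : γ e = 1 ⊗ₜ e
  ext_γ_θ : ∀ v : V, ext₁ γ (θ v) = 1 ⊗ₜ v
  ext_θ_γ : ∀ v : V, ext₁ θ (γ v) = 1 ⊗ₜ v
  compat :
    ext₂ (twistedσ R σ θ γ) ∘ₗ (ext₁ γ ∘ₗ R).rTensor V ∘ₗ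
        (TensorProduct.assoc k V A V).symm.toLinearMap ∘ₗ γ.lTensor V =
      ext₁ γ ∘ₗ σ

end CrossedProducts

/-! ### Quasi-bialgebras and gauge transformations -/

section QuasiBialgebras

variable (k H : Type*) [Field k] [Ring H] [Algebra k H]

/-- The structure maps of a quasi-bialgebra on the algebra `H`: a comultiplication and a counit,
which are algebra maps, and an invertible element `Φ` of `H ⊗ H ⊗ H`. The axioms are stated in
`IsQuasiBialgebra`. -/
structure QuasiBialgebraData where
  /-- the comultiplication `Δ` -/
  Δ : H →ₐ[k] H ⊗[k] H
  /-- the counit `ε` -/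
  ε : H →ₐ[k] k
  /-- the associator `Φ` -/
  Φ : (H ⊗[k] (H ⊗[k] H))ˣ

variable {k H}

/-- `f ⊗ id : H ⊗ X → (H ⊗ H) ⊗ X = H ⊗ (H ⊗ X)` for an algebra map `f : H → H ⊗ H`. -/
def coLeft (X : Type*) [Semiring X] [Algebra k X] (f : H →ₐ[k] H ⊗[k] H) :
    H ⊗[k] X →ₐ[k] H ⊗[k] (H ⊗[k] X) :=
  (Algebra.TensorProduct.assoc k k k H H X).toAlgHom.comp
    (Algebra.TensorProduct.map f (AlgHom.id k X))

/-- `id ⊗ f` for an algebra map `f`. -/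
def coRight {X Y : Type*} [Semiring X] [Algebra k X] [Semiring Y] [Algebra k Y] (f : X →ₐ[k] Y) :
    H ⊗[k] X →ₐ[k] H ⊗[k] Y :=
  Algebra.TensorProduct.map (AlgHom.id k H) f

/-- `x ↦ 1 ⊗ x`. -/
def oneTensor {X : Type*} [Semiring X] [Algebra k X] : X →ₐ[k] H ⊗[k] X :=
  Algebra.TensorProduct.includeRight

/-- `x ↦ x ⊗ 1`, from `H ⊗ H` to `H ⊗ H ⊗ H`. -/
def tensorOne₂ : H ⊗[k] H →ₐ[k] H ⊗[k] (H ⊗[k] H) :=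
  coRight Algebra.TensorProduct.includeLeft

/-- `x ↦ x ⊗ 1`, from `H ⊗ H ⊗ H` to `H ⊗ H ⊗ H ⊗ H`. -/
def tensorOne₃ : H ⊗[k] (H ⊗[k] H) →ₐ[k] H ⊗[k] (H ⊗[k] (H ⊗[k] H)) :=
  coRight tensorOne₂

theorem coLeft_tmul {X : Type*} [Semiring X] [Algebra k X] (f : H →ₐ[k] H ⊗[k] H) (h : H) (x : X) :
    coLeft X f (h ⊗ₜ x) = TensorProduct.assoc k H H X (f h ⊗ₜ x) := rfl

theorem tensorOne₂_tmul (g h : H) :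
    tensorOne₂ (g ⊗ₜ[k] h) = g ⊗ₜ[k] (h ⊗ₜ[k] (1 : H)) := rfl

theorem tensorOne₃_tmul (f g h : H) :
    tensorOne₃ (f ⊗ₜ[k] (g ⊗ₜ[k] h)) = f ⊗ₜ[k] (g ⊗ₜ[k] (h ⊗ₜ[k] (1 : H))) := rfl

namespace QuasiBialgebraData

variable (Q : QuasiBialgebraData k H)

/-- The axioms of a quasi-bialgebra. -/
structure IsQuasiBialgebra : Prop where
  /-- `(id ⊗ Δ)(Δ(h)) Φ = Φ (Δ ⊗ id)(Δ(h))` -/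
  quasi_coassoc : ∀ h : H, coRight Q.Δ (Q.Δ h) * Q.Φ = Q.Φ * coLeft H Q.Δ (Q.Δ h)
  /-- `(ε ⊗ id) ∘ Δ = id` -/
  counit_left : ∀ h : H,
    Algebra.TensorProduct.lid k H (Algebra.TensorProduct.map Q.ε (AlgHom.id k H) (Q.Δ h)) = h
  /-- `(id ⊗ ε) ∘ Δ = id` -/
  counit_right : ∀ h : H,
    Algebra.TensorProduct.rid k k H (Algebra.TensorProduct.map (AlgHom.id k H) Q.ε (Q.Δ h)) = h
  /-- `(1 ⊗ Φ)(id ⊗ Δ ⊗ id)(Φ)(Φ ⊗ 1) = (id ⊗ id ⊗ Δ)(Φ)(Δ ⊗ id ⊗ id)(Φ)` -/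
  pentagon :
    oneTensor (k := k) (H := H) (Q.Φ : H ⊗[k] (H ⊗[k] H)) * coRight (coLeft H Q.Δ) Q.Φ *
        tensorOne₃ Q.Φ =
      coRight (coRight Q.Δ) (Q.Φ : H ⊗[k] (H ⊗[k] H)) * coLeft (H ⊗[k] H) Q.Δ Q.Φ
  /-- `(id ⊗ ε ⊗ id)(Φ) = 1 ⊗ 1` -/
  counit_Φ :
    coRight ((Algebra.TensorProduct.lid k H).toAlgHom.comp
      (Algebra.TensorProduct.map Q.ε (AlgHom.id k H))) (Q.Φ : H ⊗[k] (H ⊗[k] H)) = 1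

/-- A gauge transformation: an invertible `F ∈ H ⊗ H` with `(ε ⊗ id)(F) = (id ⊗ ε)(F) = 1`. -/
structure IsGauge (F : (H ⊗[k] H)ˣ) : Prop where
  counit_left :
    Algebra.TensorProduct.lid k H (Algebra.TensorProduct.map Q.ε (AlgHom.id k H) F) = 1
  counit_right :
    Algebra.TensorProduct.rid k k H (Algebra.TensorProduct.map (AlgHom.id k H) Q.ε F) = 1

/-- The Drinfeld twist `H_F`: same algebra and counit, `Δ_F(h) = F Δ(h) F⁻¹` and
`Φ_F = (1 ⊗ F) (id ⊗ Δ)(F) Φ (Δ ⊗ id)(F⁻¹) (F⁻¹ ⊗ 1)`. -/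
def twist (F : (H ⊗[k] H)ˣ) : QuasiBialgebraData k H where
  Δ :=
    { toFun := fun h => F * Q.Δ h * (F⁻¹ : (H ⊗[k] H)ˣ)
      map_one' := by simp
      map_mul' := fun g h => by simp [mul_assoc]
      map_zero' := by simp
      map_add' := fun g h => by simp [mul_add, add_mul]
      commutes' := fun r => by
        rw [Q.Δ.commutes, ← Algebra.commutes, mul_assoc, Units.mul_inv, mul_one] }
  ε := Q.ε
  Φ := Units.map (oneTensor (k := k) (H := H) (X := H ⊗[k] H) : _ →* _) F *
    Units.map (coRight (H := H) Q.Δ : _ →* _) F * Q.Φ *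
    Units.map (coLeft H Q.Δ : _ →* _) F⁻¹ * Units.map (tensorOne₂ (k := k) (H := H) : _ →* _) F⁻¹

end QuasiBialgebraData

end QuasiBialgebras

/-! ### Right module algebras and smash products -/

section ModuleAlgebras

variable (k H B : Type*) [Field k] [Ring H] [Algebra k H] [AddCommGroup B] [Module k B]

/-- The structure maps of a right `H`-module algebra on the vector space `B`: an action
`b · h = act b h`, a multiplication (not necessarily associative) and a unit element. The axioms
are stated in `IsModuleAlgebra`. -/
structure ModuleAlgebraData where
  /-- the right action `b · h` -/
  act : B →ₗ[k] H →ₗ[k] B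
  /-- the multiplication -/
  mul : B →ₗ[k] B →ₗ[k] B
  /-- the unit -/
  one : B

variable {k H B}

namespace ModuleAlgebraData

variable (D : ModuleAlgebraData k H B)

/-- `T¹ ⊗ T² ↦ (b · T¹)(b' · T²)`, bilinear in `b` and `b'`. -/
def mulAct : B →ₗ[k] B →ₗ[k] H ⊗[k] H →ₗ[k] B :=
  LinearMap.mk₂ k (fun b b' => TensorProduct.lift D.mul ∘ₗ TensorProduct.map (D.act b) (D.act b'))
    (fun _ _ _ => by ext; simp) (fun _ _ _ => by ext; simp)
    (fun _ _ _ => by ext; simp) (fun _ _ _ => by ext; simp)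

theorem mulAct_tmul (b b' : B) (g h : H) :
    D.mulAct b b' (g ⊗ₜ h) = D.mul (D.act b g) (D.act b' h) := rfl

/-- `T¹ ⊗ T² ⊗ T³ ↦ (b · T¹)((b' · T²)(b'' · T³))`. -/
def mulAct₃ (b b' b'' : B) : H ⊗[k] (H ⊗[k] H) →ₗ[k] B :=
  TensorProduct.lift D.mul ∘ₗ TensorProduct.map (D.act b) (D.mulAct b' b'')

theorem mulAct₃_tmul (b b' b'' : B) (f g h : H) :
    D.mulAct₃ b b' b'' (f ⊗ₜ (g ⊗ₜ h)) =
      D.mul (D.act b f) (D.mul (D.act b' g) (D.act b'' h)) := rfl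

/-- The axioms of a right module algebra over the quasi-bialgebra `H`, that is, of an algebra in
the monoidal category of right `H`-modules: `B` is a right `H`-module with a unit
`1_B` of the multiplication, the multiplication and the unit are `H`-linear, and
`(b b') b'' = (b · x¹)((b' · x²)(b'' · x³))` where `Φ⁻¹ = x¹ ⊗ x² ⊗ x³`. -/
structure IsModuleAlgebra (Q : QuasiBialgebraData k H) : Prop where
  act_one : ∀ b : B, D.act b 1 = b
  act_mul : ∀ (b : B) (g h : H), D.act b (g * h) = D.act (D.act b g) h
  one_mul : ∀ b : B, D.mul D.one b = b
  mul_one : ∀ b : B, D.mul b D.one = b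
  mul_act : ∀ (b b' : B) (h : H), D.act (D.mul b b') h = D.mulAct b b' (Q.Δ h)
  one_act : ∀ h : H, D.act D.one h = Q.ε h • D.one
  quasi_assoc : ∀ b b' b'' : B,
    D.mul (D.mul b b') b'' = D.mulAct₃ b b' b'' ((Q.Φ⁻¹ : (H ⊗[k] (H ⊗[k] H))ˣ) : _)

/-- `_F B`: same space, action and unit as `B`, with the multiplication
`b * b' = (b · F¹)(b' · F²)`. -/
def twist (F : H ⊗[k] H) : ModuleAlgebraData k H B where
  act := D.act
  mul := D.mulAct.compr₂ (LinearMap.applyₗ F)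
  one := D.one

theorem twist_mul (F : H ⊗[k] H) (b b' : B) : (D.twist F).mul b b' = D.mulAct b b' F := rfl

/-- `b ↦ T¹ ⊗ b · T²` for `T ∈ H ⊗ H`. -/
def legAct (T : H ⊗[k] H) : B →ₗ[k] H ⊗[k] B :=
  LinearMap.applyₗ T ∘ₗ LinearMap.lTensorHom H ∘ₗ D.act

theorem legAct_tmul (g h : H) (b : B) : D.legAct (g ⊗ₜ h) b = g ⊗ₜ D.act b h := rfl

/-- `R : B ⊗ H → H ⊗ B`, `R(b ⊗ h) = h₁ ⊗ b · h₂`. -/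
def smashR (Q : QuasiBialgebraData k H) : B ⊗[k] H →ₗ[k] H ⊗[k] B :=
  TensorProduct.lift ((LinearMap.lTensorHom H ∘ₗ D.act).compl₂ Q.Δ.toLinearMap)

theorem smashR_tmul (Q : QuasiBialgebraData k H) (b : B) (h : H) :
    D.smashR Q (b ⊗ₜ h) = D.legAct (Q.Δ h) b := rfl

/-- `σ : B ⊗ B → H ⊗ B`, `σ(b, b') = x¹ ⊗ (b · x²)(b' · x³)`, where `Φ⁻¹ = x¹ ⊗ x² ⊗ x³`. -/
def smashσ (Q : QuasiBialgebraData k H) : B ⊗[k] B →ₗ[k] H ⊗[k] B :=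
  TensorProduct.lift (D.mulAct.compr₂ (LinearMap.applyₗ
    ((Q.Φ⁻¹ : (H ⊗[k] (H ⊗[k] H))ˣ) : H ⊗[k] (H ⊗[k] H)) ∘ₗ LinearMap.lTensorHom H))

theorem smashσ_tmul (Q : QuasiBialgebraData k H) (b b' : B) :
    D.smashσ Q (b ⊗ₜ b') =
      (D.mulAct b b').lTensor H ((Q.Φ⁻¹ : (H ⊗[k] (H ⊗[k] H))ˣ) : H ⊗[k] (H ⊗[k] H)) := rfl

/-- The element `h h'₁ x¹ ⊗ h'₂ x² ⊗ x³` of `H ⊗ H ⊗ H`, bilinear in `h` and `h'`, where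
`Φ⁻¹ = x¹ ⊗ x² ⊗ x³`. -/
def smashElement (Q : QuasiBialgebraData k H) : H →ₗ[k] H →ₗ[k] H ⊗[k] (H ⊗[k] H) :=
  LinearMap.mk₂ k
    (fun h h' => (h ⊗ₜ[k] (1 : H ⊗[k] H)) * tensorOne₂ (Q.Δ h') *
      ((Q.Φ⁻¹ : (H ⊗[k] (H ⊗[k] H))ˣ) : H ⊗[k] (H ⊗[k] H)))
    (fun _ _ _ => by simp only [TensorProduct.add_tmul, add_mul])
    (fun _ _ _ => by simp only [← TensorProduct.smul_tmul', smul_mul_assoc])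
    (fun _ _ _ => by simp only [map_add, mul_add, add_mul])
    (fun _ _ _ => by simp only [map_smul, mul_smul_comm, smul_mul_assoc])

/-- The multiplication of the smash product `H # B`:
`(h # b)(h' # b') = h h'₁ x¹ # (b · h'₂ x²)(b' · x³)`, where `Φ⁻¹ = x¹ ⊗ x² ⊗ x³`. -/
def smashMul (Q : QuasiBialgebraData k H) : H ⊗[k] B →ₗ[k] H ⊗[k] B →ₗ[k] H ⊗[k] B :=
  TensorProduct.curry
    (TensorProduct.lift
      ((LinearMap.lTensorHom H ∘ₗ TensorProduct.lift D.mulAct).flip ∘ₗ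
        TensorProduct.lift (smashElement Q))
      ∘ₗ (TensorProduct.tensorTensorTensorComm k H B H B).toLinearMap)

theorem smashMul_tmul (Q : QuasiBialgebraData k H) (h h' : H) (b b' : B) :
    D.smashMul Q (h ⊗ₜ b) (h' ⊗ₜ b') =
      (D.mulAct b b').lTensor H ((h ⊗ₜ[k] (1 : H ⊗[k] H)) * tensorOne₂ (Q.Δ h') *
        ((Q.Φ⁻¹ : (H ⊗[k] (H ⊗[k] H))ˣ) : H ⊗[k] (H ⊗[k] H))) := rfl

end ModuleAlgebraData

end ModuleAlgebras

end QuasiSmash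

end

/-!
Since `θ̂` and `γ̂` are mutually inverse left `A`-linear maps and the multiplication of a crossed
product is determined by left `A`-linearity, `R` and `σ`, the maps `R'` and `σ'` are exactly those
which make `θ̂` multiplicative; so the last twisting condition and the isomorphism are formal. For
smash products all maps involved are of the form `b ⊗ b' ↦ T¹ ⊗ (b · T²)(b' · T³)` for tensors `T`
over `H`, and composing such maps multiplies the tensors. The crossed product axioms then become
quasi-coassociativity, the pentagon identity for `Φ⁻¹` and the counit identities, while `R' = R_F`
and `σ' = σ_F` become `F Δ(h) F⁻¹ = Δ_F(h)` and
`(F ⊗ 1) (Δ ⊗ id)(F) Φ⁻¹ (id ⊗ Δ)(F⁻¹) = Φ_F⁻¹ (1 ⊗ F)`.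
-/

noncomputable section

namespace QuasiSmash

/-! ### Crossed products and their twisting -/

section CrossedProducts

variable {k A V X : Type*} [Field k] [Ring A] [Algebra k A] [AddCommGroup V] [Module k V]
  [AddCommGroup X] [Module k X]

theorem mulId_tmul (a : A) (x : A ⊗[k] V) : mulId k A V (a ⊗ₜ x) = a • x := by
  induction x with
  | zero => simp only [TensorProduct.tmul_zero, map_zero, smul_zero]
  | add x y hx hy => simp only [TensorProduct.tmul_add, map_add, smul_add, hx, hy]
  | tmul a' v => rfl

theorem smul_one_tmul (a : A) (v : V) : a • ((1 : A) ⊗ₜ[k] v) = a ⊗ₜ v := by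
  rw [TensorProduct.smul_tmul', smul_eq_mul, mul_one]

theorem ext₁_tmul (f : V →ₗ[k] A ⊗[k] V) (a : A) (v : V) : ext₁ f (a ⊗ₜ v) = a • f v :=
  mulId_tmul a (f v)

theorem ext₁_one_tmul (f : V →ₗ[k] A ⊗[k] V) (v : V) : ext₁ f (1 ⊗ₜ v) = f v := by
  rw [ext₁_tmul, one_smul]

theorem ext₁_smul (f : V →ₗ[k] A ⊗[k] V) (a : A) (x : A ⊗[k] V) :
    ext₁ f (a • x) = a • ext₁ f x := by
  induction x with
  | zero => simp only [smul_zero, map_zero]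
  | add x y hx hy => simp only [smul_add, map_add, hx, hy]
  | tmul a' v => rw [TensorProduct.smul_tmul', ext₁_tmul, ext₁_tmul, smul_assoc]

theorem ext₂_tmul (f : V ⊗[k] X →ₗ[k] A ⊗[k] V) (a : A) (v : V) (x : X) :
    ext₂ f ((a ⊗ₜ v) ⊗ₜ x) = a • f (v ⊗ₜ x) :=
  mulId_tmul a (f (v ⊗ₜ x))

theorem ext₂_one_tmul (f : V ⊗[k] X →ₗ[k] A ⊗[k] V) (v : V) (x : X) :
    ext₂ f ((1 ⊗ₜ v) ⊗ₜ x) = f (v ⊗ₜ x) := by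
  rw [ext₂_tmul, one_smul]

theorem ext₂_smul (f : V ⊗[k] X →ₗ[k] A ⊗[k] V) (a : A) (y : A ⊗[k] V) (x : X) :
    ext₂ f ((a • y) ⊗ₜ x) = a • ext₂ f (y ⊗ₜ x) := by
  induction y with
  | zero => simp only [smul_zero, TensorProduct.zero_tmul, map_zero]
  | add y z hy hz => simp only [smul_add, TensorProduct.add_tmul, map_add, hy, hz]
  | tmul a' v => rw [TensorProduct.smul_tmul', ext₂_tmul, ext₂_tmul, smul_assoc]

section

variable (R : V ⊗[k] A →ₗ[k] A ⊗[k] V) (σ : V ⊗[k] V →ₗ[k] A ⊗[k] V)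

theorem crossedMul_tmul (x : A ⊗[k] V) (a : A) (v : V) :
    crossedMul R σ x (a ⊗ₜ v) = ext₂ σ (ext₂ R (x ⊗ₜ a) ⊗ₜ v) := rfl

theorem crossedMul_smul_left (a : A) (x y : A ⊗[k] V) :
    crossedMul R σ (a • x) y = a • crossedMul R σ x y := by
  induction y with
  | zero => simp only [map_zero, smul_zero]
  | add y z hy hz => simp only [map_add, smul_add, hy, hz]
  | tmul a' v => rw [crossedMul_tmul, crossedMul_tmul, ext₂_smul, ext₂_smul]

theorem crossedMul_one_tmul_left (v : V) (y : A ⊗[k] V) :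
    crossedMul R σ (1 ⊗ₜ v) y =
      ext₂ σ (R.rTensor V ((TensorProduct.assoc k V A V).symm (v ⊗ₜ y))) := by
  induction y with
  | zero => simp only [TensorProduct.tmul_zero, map_zero]
  | add y z hy hz => simp only [TensorProduct.tmul_add, map_add, hy, hz]
  | tmul a w => rw [crossedMul_tmul, ext₂_one_tmul]; rfl

end

namespace IsCrossedProduct

variable {e : V} {R : V ⊗[k] A →ₗ[k] A ⊗[k] V} {σ : V ⊗[k] V →ₗ[k] A ⊗[k] V}
  (h : IsCrossedProduct e R σ)
include h

theorem ext₂_R_one (x : A ⊗[k] V) : ext₂ R (x ⊗ₜ 1) = x := by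
  induction x with
  | zero => simp only [TensorProduct.zero_tmul, map_zero]
  | add x y hx hy => simp only [TensorProduct.add_tmul, map_add, hx, hy]
  | tmul a v => rw [ext₂_tmul, h.R_one_right, smul_one_tmul]

theorem ext₂_R_mul (x : A ⊗[k] V) (a b : A) :
    ext₂ R (x ⊗ₜ (a * b)) = ext₂ R (ext₂ R (x ⊗ₜ a) ⊗ₜ b) := by
  induction x with
  | zero => simp only [TensorProduct.zero_tmul, map_zero]
  | add x y hx hy => simp only [TensorProduct.add_tmul, map_add, hx, hy]
  | tmul c v =>
    have hR : R (v ⊗ₜ (a * b)) = ext₂ R (R (v ⊗ₜ a) ⊗ₜ b) :=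
      LinearMap.congr_fun h.R_mul (v ⊗ₜ (a ⊗ₜ b))
    rw [ext₂_tmul, ext₂_tmul, ext₂_smul, hR]

theorem crossedMul_one_tmul (x : A ⊗[k] V) (v : V) :
    crossedMul R σ x (1 ⊗ₜ v) = ext₂ σ (x ⊗ₜ v) := by
  rw [crossedMul_tmul, h.ext₂_R_one]

theorem crossedMul_smul_right (x : A ⊗[k] V) (a : A) (y : A ⊗[k] V) :
    crossedMul R σ x (a • y) = crossedMul R σ (ext₂ R (x ⊗ₜ a)) y := by
  induction y with
  | zero => simp only [smul_zero, map_zero]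
  | add y z hy hz => simp only [smul_add, map_add, hy, hz]
  | tmul a' v =>
    rw [TensorProduct.smul_tmul', smul_eq_mul, crossedMul_tmul, crossedMul_tmul, h.ext₂_R_mul]

theorem ext₂_σ_ext₂_σ (x : A ⊗[k] V) (v w : V) :
    ext₂ σ (ext₂ σ (x ⊗ₜ v) ⊗ₜ w) = crossedMul R σ x (σ (v ⊗ₜ w)) := by
  induction x with
  | zero => simp only [TensorProduct.zero_tmul, map_zero, LinearMap.zero_apply]
  | add x y hx hy => simp only [TensorProduct.add_tmul, map_add, LinearMap.add_apply, hx, hy]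
  | tmul a u =>
    have hσ : ext₂ σ (σ (u ⊗ₜ v) ⊗ₜ w) = crossedMul R σ (1 ⊗ₜ u) (σ (v ⊗ₜ w)) := by
      rw [crossedMul_one_tmul_left]
      exact (LinearMap.congr_fun h.σ_cocycle (u ⊗ₜ (v ⊗ₜ w))).symm
    rw [ext₂_tmul, ext₂_smul, hσ, ← crossedMul_smul_left, smul_one_tmul]

theorem ext₂_R_ext₂_σ (x : A ⊗[k] V) (v : V) (a : A) :
    ext₂ R (ext₂ σ (x ⊗ₜ v) ⊗ₜ a) = crossedMul R σ x (R (v ⊗ₜ a)) := by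
  induction x with
  | zero => simp only [TensorProduct.zero_tmul, map_zero, LinearMap.zero_apply]
  | add x y hx hy => simp only [TensorProduct.add_tmul, map_add, LinearMap.add_apply, hx, hy]
  | tmul b u =>
    have hR : ext₂ R (σ (u ⊗ₜ v) ⊗ₜ a) = crossedMul R σ (1 ⊗ₜ u) (R (v ⊗ₜ a)) := by
      rw [crossedMul_one_tmul_left]
      exact (LinearMap.congr_fun h.twisted_module (u ⊗ₜ (v ⊗ₜ a))).symm
    rw [ext₂_tmul, ext₂_smul, hR, ← crossedMul_smul_left, smul_one_tmul]

theorem ext₂_R_crossedMul (x y : A ⊗[k] V) (a : A) :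
    ext₂ R (crossedMul R σ x y ⊗ₜ a) = crossedMul R σ x (ext₂ R (y ⊗ₜ a)) := by
  induction y with
  | zero => simp only [map_zero, TensorProduct.zero_tmul]
  | add y z hy hz => simp only [map_add, TensorProduct.add_tmul, hy, hz]
  | tmul b v => rw [crossedMul_tmul, h.ext₂_R_ext₂_σ, ext₂_tmul, h.crossedMul_smul_right]

theorem ext₂_σ_crossedMul (x y : A ⊗[k] V) (v : V) :
    ext₂ σ (crossedMul R σ x y ⊗ₜ v) = crossedMul R σ x (ext₂ σ (y ⊗ₜ v)) := by
  induction y with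
  | zero => simp only [map_zero, TensorProduct.zero_tmul]
  | add y z hy hz => simp only [map_add, TensorProduct.add_tmul, hy, hz]
  | tmul b w => rw [crossedMul_tmul, h.ext₂_σ_ext₂_σ, ext₂_tmul, h.crossedMul_smul_right]

theorem isAlgebraStructure : IsAlgebraStructure (crossedMul R σ) (1 ⊗ₜ e) where
  mul_assoc x y z := by
    induction z with
    | zero => simp only [map_zero]
    | add z w hz hw => simp only [map_add, hz, hw]
    | tmul a v => rw [crossedMul_tmul, crossedMul_tmul, h.ext₂_R_crossedMul, h.ext₂_σ_crossedMul]
  one_mul x := by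
    induction x with
    | zero => simp only [map_zero]
    | add x y hx hy => simp only [map_add, hx, hy]
    | tmul a v =>
      rw [crossedMul_tmul, ext₂_one_tmul, h.R_one_left, ext₂_tmul, h.σ_one_left, smul_one_tmul]
  mul_one x := by
    rw [h.crossedMul_one_tmul]
    induction x with
    | zero => simp only [TensorProduct.zero_tmul, map_zero]
    | add x y hx hy => simp only [TensorProduct.add_tmul, map_add, hx, hy]
    | tmul a v => rw [ext₂_tmul, h.σ_one_right, smul_one_tmul]

end IsCrossedProduct

section Twisting

variable {θ γ : V →ₗ[k] A ⊗[k] V} {e : V} {R : V ⊗[k] A →ₗ[k] A ⊗[k] V}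
  {σ : V ⊗[k] V →ₗ[k] A ⊗[k] V}

theorem ext₁_ext₁ (h : ∀ v, ext₁ γ (θ v) = 1 ⊗ₜ v) (x : A ⊗[k] V) :
    ext₁ γ (ext₁ θ x) = x := by
  induction x with
  | zero => simp only [map_zero]
  | add x y hx hy => simp only [map_add, hx, hy]
  | tmul a v => rw [ext₁_tmul, ext₁_smul, h, smul_one_tmul]

theorem ext₂_twistedR (x : A ⊗[k] V) (a : A) :
    ext₂ (twistedR R θ γ) (x ⊗ₜ a) = ext₁ γ (ext₂ R (ext₁ θ x ⊗ₜ a)) := by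
  induction x with
  | zero => simp only [TensorProduct.zero_tmul, map_zero]
  | add x y hx hy => simp only [TensorProduct.add_tmul, map_add, hx, hy]
  | tmul b v => rw [ext₂_tmul, ext₁_tmul, ext₂_smul, ext₁_smul]; rfl

theorem ext₂_twistedσ (x : A ⊗[k] V) (w : V) :
    ext₂ (twistedσ R σ θ γ) (x ⊗ₜ w) = ext₁ γ (crossedMul R σ (ext₁ θ x) (θ w)) := by
  induction x with
  | zero => simp only [TensorProduct.zero_tmul, map_zero, LinearMap.zero_apply]
  | add x y hx hy => simp only [TensorProduct.add_tmul, map_add, LinearMap.add_apply, hx, hy]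
  | tmul b v => rw [ext₂_tmul, ext₁_tmul, crossedMul_smul_left, ext₁_smul]; rfl

theorem IsCrossedProduct.crossedMul_twisted (hX : IsCrossedProduct e R σ)
    (hθγ : ∀ v, ext₁ θ (γ v) = 1 ⊗ₜ v) (x y : A ⊗[k] V) :
    crossedMul (twistedR R θ γ) (twistedσ R σ θ γ) x y =
      ext₁ γ (crossedMul R σ (ext₁ θ x) (ext₁ θ y)) := by
  induction y with
  | zero => simp only [map_zero]
  | add y z hy hz => simp only [map_add, hy, hz]
  | tmul a v =>
    rw [crossedMul_tmul, ext₂_twistedR, ext₂_twistedσ, ext₁_ext₁ hθγ, ext₁_tmul θ a v,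
      hX.crossedMul_smul_right]

/-- Composing with the isomorphism `ext₁ θ`, the last twisting condition becomes
`(1 ⊗ v)(1 ⊗ w) = σ(v ⊗ w)`, which holds in every crossed product. -/
theorem IsCrossedProduct.isTwistingPair (hX : IsCrossedProduct e R σ)
    (θ_one : θ e = 1 ⊗ₜ e) (γ_one : γ e = 1 ⊗ₜ e)
    (ext_γ_θ : ∀ v, ext₁ γ (θ v) = 1 ⊗ₜ v) (ext_θ_γ : ∀ v, ext₁ θ (γ v) = 1 ⊗ₜ v) :
    IsTwistingPair e R σ θ γ where
  θ_one := θ_one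
  γ_one := γ_one
  ext_γ_θ := ext_γ_θ
  ext_θ_γ := ext_θ_γ
  compat := by
    have key (v : V) (y : A ⊗[k] V) :
        ext₂ (twistedσ R σ θ γ) ((ext₁ γ ∘ₗ R).rTensor V
          ((TensorProduct.assoc k V A V).symm (v ⊗ₜ y))) =
        ext₁ γ (crossedMul R σ (1 ⊗ₜ v) (ext₁ θ y)) := by
      induction y with
      | zero => simp only [TensorProduct.tmul_zero, map_zero]
      | add y z hy hz => simp only [TensorProduct.tmul_add, map_add, hy, hz]
      | tmul a w =>
        rw [TensorProduct.assoc_symm_tmul, LinearMap.rTensor_tmul, LinearMap.comp_apply,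
          ext₂_twistedσ, ext₁_ext₁ ext_θ_γ, ext₁_tmul θ, hX.crossedMul_smul_right, ext₂_one_tmul]
    refine TensorProduct.ext' fun v w => (key v (γ w)).trans ?_
    rw [ext_θ_γ, hX.crossedMul_one_tmul, ext₂_one_tmul, LinearMap.comp_apply]

namespace IsTwistingPair

/-- The linear automorphism `a ⊗ v ↦ a θ(v)` of `A ⊗ V`, with inverse `a ⊗ v ↦ a γ(v)`. -/
def linearEquiv (hθ : IsTwistingPair e R σ θ γ) : (A ⊗[k] V) ≃ₗ[k] A ⊗[k] V :=
  LinearEquiv.ofLinearMap (ext₁ θ) (ext₁ γ) (LinearMap.ext (ext₁_ext₁ hθ.ext_θ_γ))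
    (LinearMap.ext (ext₁_ext₁ hθ.ext_γ_θ))

/-- Invariance under twisting: `a ⊗ v ↦ a θ(v)` as an algebra isomorphism
`A ⊗_{R', σ'} V ≅ A ⊗_{R, σ} V`. -/
def algEquiv (hθ : IsTwistingPair e R σ θ γ) (hX : IsCrossedProduct e R σ)
    (hS : IsAlgebraStructure (crossedMul R σ) (1 ⊗ₜ e))
    (hT : IsAlgebraStructure (crossedMul (twistedR R θ γ) (twistedσ R σ θ γ)) (1 ⊗ₜ e)) :
    AlgebraOf hT ≃ₐ[k] AlgebraOf hS :=
  AlgEquiv.ofLinearEquiv ((AlgebraOf.of hT).symm ≪≫ₗ hθ.linearEquiv ≪≫ₗ AlgebraOf.of hS)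
    ((ext₁_one_tmul θ e).trans hθ.θ_one)
    fun x y => (congrArg (ext₁ θ) (hX.crossedMul_twisted hθ.ext_θ_γ x y)).trans
      (ext₁_ext₁ hθ.ext_θ_γ _)

theorem algEquiv_of (hθ : IsTwistingPair e R σ θ γ) (hX : IsCrossedProduct e R σ)
    (hS : IsAlgebraStructure (crossedMul R σ) (1 ⊗ₜ e))
    (hT : IsAlgebraStructure (crossedMul (twistedR R θ γ) (twistedσ R σ θ γ)) (1 ⊗ₜ e))
    (x : A ⊗[k] V) :
    hθ.algEquiv hX hS hT (AlgebraOf.of hT x) = AlgebraOf.of hS (ext₁ θ x) := rfl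

end IsTwistingPair

end Twisting

end CrossedProducts

/-! ### Quasi-bialgebras and gauge transformations -/

section TensorAlgebras

variable {k H X Y Z : Type*} [Field k] [Ring H] [Algebra k H] [Semiring X] [Algebra k X]
  [Semiring Y] [Algebra k Y] [Semiring Z] [Algebra k Z]

theorem coRight_tmul (f : X →ₐ[k] Y) (h : H) (x : X) : coRight f (h ⊗ₜ[k] x) = h ⊗ₜ f x := rfl

theorem oneTensor_apply (x : X) : oneTensor (k := k) (H := H) x = 1 ⊗ₜ x := rfl

theorem coRight_coRight (f : X →ₐ[k] Y) (g : Y →ₐ[k] Z) (x : H ⊗[k] X) :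
    coRight g (coRight f x) = coRight (g.comp f) x :=
  (DFunLike.congr_fun (Algebra.TensorProduct.map_id_comp (S := k) g f) x).symm

theorem coRight_id : coRight (H := H) (AlgHom.id k X) = AlgHom.id k (H ⊗[k] X) :=
  Algebra.TensorProduct.map_id

theorem coRight_coRight_of_leftInverse (f : X →ₐ[k] Y) (g : Y →ₐ[k] X) (h : ∀ x, g (f x) = x)
    (x : H ⊗[k] X) : coRight g (coRight f x) = x := by
  have hgf : g.comp f = AlgHom.id k X := AlgHom.ext h
  rw [coRight_coRight, hgf, coRight_id, AlgHom.id_apply]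

theorem coRight_oneTensor (f : X →ₐ[k] Y) (x : X) :
    coRight f (oneTensor (H := H) x) = oneTensor (f x) := rfl

theorem coRight_conj {f g : X →ₐ[k] Y} {u v : Y} (hg : ∀ x, g x = u * f x * v) (x : H ⊗[k] X) :
    coRight g x = oneTensor u * coRight f x * oneTensor v := by
  induction x with
  | zero => simp only [map_zero, mul_zero, zero_mul]
  | add x y hx hy => simp only [map_add, mul_add, add_mul, hx, hy]
  | tmul a x =>
    simp only [coRight_tmul, oneTensor_apply, Algebra.TensorProduct.tmul_mul_tmul, one_mul,
      mul_one, hg]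

theorem semiconjBy_of_tmul {f g : H ⊗[k] X →ₐ[k] Y} {u : Y}
    (hu : ∀ h x, SemiconjBy u (f (h ⊗ₜ x)) (g (h ⊗ₜ x))) (t : H ⊗[k] X) :
    SemiconjBy u (f t) (g t) := by
  induction t with
  | zero => simp only [map_zero, SemiconjBy.zero_right]
  | add s t hs ht => simpa only [map_add] using hs.add_right ht
  | tmul h x => exact hu h x

theorem semiconjBy_coRight {f g : X →ₐ[k] Y} {u : Y} (hu : ∀ x, SemiconjBy u (f x) (g x))
    (t : H ⊗[k] X) : SemiconjBy (oneTensor u) (coRight f t) (coRight g t) :=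
  semiconjBy_of_tmul (fun h x => by
    simp only [SemiconjBy, coRight_tmul, oneTensor_apply, Algebra.TensorProduct.tmul_mul_tmul,
      one_mul, mul_one, (hu x).eq]) t

theorem coLeft_oneTensor (f : H →ₐ[k] H ⊗[k] H) (x : X) :
    coLeft X f (oneTensor x) = oneTensor (oneTensor x) := by
  simp only [oneTensor_apply, coLeft_tmul, map_one, Algebra.TensorProduct.one_def,
    TensorProduct.assoc_tmul]

/-- `t ↦ t ⊗ 1`, from `H ⊗ X` to `H ⊗ X ⊗ Y`; the maps `tensorOne₂` and `tensorOne₃` are built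
from the case `X = H`. -/
def tensorOne (Y : Type*) [Semiring Y] [Algebra k Y] : H ⊗[k] X →ₐ[k] H ⊗[k] (X ⊗[k] Y) :=
  coRight Algebra.TensorProduct.includeLeft

theorem tensorOne_tmul (h : H) (x : X) : tensorOne Y (h ⊗ₜ[k] x) = h ⊗ₜ (x ⊗ₜ 1) := rfl

theorem commute_oneTensor_tensorOne (y : Y) (t : H ⊗[k] H) :
    Commute (oneTensor (oneTensor y)) (tensorOne Y t) :=
  semiconjBy_coRight (fun h => by
    simp only [SemiconjBy, oneTensor_apply, Algebra.TensorProduct.includeLeft_apply,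
      Algebra.TensorProduct.tmul_mul_tmul, one_mul, mul_one]) t

theorem coLeft_tmul_eq_mul (f : H →ₐ[k] H ⊗[k] H) (h : H) (x : X) :
    coLeft X f (h ⊗ₜ x) = tensorOne X (f h) * oneTensor (oneTensor x) := by
  rw [coLeft_tmul]
  induction f h with
  | zero => simp only [TensorProduct.zero_tmul, map_zero, zero_mul]
  | add s t hs ht => simp only [TensorProduct.add_tmul, map_add, add_mul, hs, ht]
  | tmul a b =>
    simp only [tensorOne_tmul, oneTensor_apply, TensorProduct.assoc_tmul,
      Algebra.TensorProduct.tmul_mul_tmul, one_mul, mul_one]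

theorem coRight_coRight_tensorOne (g : Y →ₐ[k] Z) (t : H ⊗[k] H) :
    coRight (coRight g) (tensorOne Y t) = tensorOne Z t := by
  induction t with
  | zero => simp only [map_zero]
  | add s t hs ht => simp only [map_add, hs, ht]
  | tmul h x => rw [tensorOne_tmul, coRight_tmul, coRight_tmul, map_one, tensorOne_tmul]

theorem coLeft_coRight (f : H →ₐ[k] H ⊗[k] H) (g : X →ₐ[k] Y) (t : H ⊗[k] X) :
    coLeft Y f (coRight g t) = coRight (coRight g) (coLeft X f t) := by
  induction t with
  | zero => simp only [map_zero]
  | add s t hs ht => simp only [map_add, hs, ht]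
  | tmul h x =>
    rw [coRight_tmul, coLeft_tmul_eq_mul, coLeft_tmul_eq_mul, map_mul, coRight_oneTensor,
      coRight_oneTensor, coRight_coRight_tensorOne]

theorem coRight_coLeft_tensorOne₂ (f : H →ₐ[k] H ⊗[k] H) (t : H ⊗[k] H) :
    coRight (coLeft H f) (tensorOne₂ t) = tensorOne₃ (coRight f t) := by
  have hf : (coLeft H f).comp Algebra.TensorProduct.includeLeft = tensorOne₂.comp f := by
    ext h
    simp only [AlgHom.comp_apply, Algebra.TensorProduct.includeLeft_apply, coLeft_tmul_eq_mul,
      map_one, mul_one]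
    rfl
  rw [tensorOne₂, tensorOne₃, coRight_coRight, coRight_coRight, hf]

theorem coLeft_tensorOne₂ (f : H →ₐ[k] H ⊗[k] H) (t : H ⊗[k] H) :
    coLeft (H ⊗[k] H) f (tensorOne₂ t) = tensorOne₃ (coLeft H f t) :=
  coLeft_coRight f _ t

theorem tensorOne₃_tensorOne₂ (t : H ⊗[k] H) :
    tensorOne₃ (tensorOne₂ t) = tensorOne (H ⊗[k] H) t :=
  coRight_coRight _ _ t

theorem tensorOne₃_oneTensor (t : H ⊗[k] H) :
    tensorOne₃ (oneTensor t) = oneTensor (k := k) (H := H) (tensorOne₂ t) := rfl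

theorem assoc_tmul_one (t : H ⊗[k] H) :
    Algebra.TensorProduct.assoc k k k H H H (t ⊗ₜ 1) = tensorOne₂ t := by
  induction t with
  | zero => simp only [TensorProduct.zero_tmul, map_zero]
  | add s t hs ht => simp only [TensorProduct.add_tmul, map_add, hs, ht]
  | tmul g h => rfl

theorem coRight_assoc_tensorOne (t : H ⊗[k] (H ⊗[k] H)) :
    coRight (Algebra.TensorProduct.assoc k k k H H H).toAlgHom (tensorOne H t) =
      tensorOne₃ t := by
  have hassoc : (Algebra.TensorProduct.assoc k k k H H H).toAlgHom.comp
      Algebra.TensorProduct.includeLeft = tensorOne₂ :=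
    AlgHom.ext assoc_tmul_one
  rw [tensorOne, coRight_coRight, hassoc, tensorOne₃]

theorem commute_oneTensor_tensorOne₃ (h : H) (t : H ⊗[k] (H ⊗[k] H)) :
    Commute (oneTensor (oneTensor (oneTensor h))) (tensorOne₃ t) :=
  semiconjBy_coRight (commute_oneTensor_tensorOne h) t

end TensorAlgebras

section Units

variable {k M N : Type*} [CommSemiring k] [Semiring M] [Algebra k M] [Semiring N] [Algebra k N]

/-- The group homomorphism `Mˣ → Nˣ` induced by an algebra map `M → N`, which allows identities
between invertible tensors to be proved in a group. -/
def unitsMap (f : M →ₐ[k] N) : Mˣ →* Nˣ := Units.map (f : M →* N)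

theorem val_unitsMap (f : M →ₐ[k] N) (u : Mˣ) : (unitsMap f u : N) = f u := rfl

theorem map_units_inv_mul_cancel (f : M →ₐ[k] N) (u : Mˣ) (x : N) :
    f (↑u⁻¹ : M) * (f u * x) = x :=
  (unitsMap f u).inv_mul_cancel_left x

theorem map_units_inv_eq_one {f : M →ₐ[k] N} {u : Mˣ} (h : f u = 1) : f (↑u⁻¹ : M) = 1 := by
  have hu : unitsMap f u = 1 := Units.ext h
  rw [← val_unitsMap, map_inv, hu, inv_one, Units.val_one]

end Units

section Counits

variable {k H X : Type*} [Field k] [Ring H] [Algebra k H] [Semiring X] [Algebra k X]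
  (ε : H →ₐ[k] k)

/-- `ε ⊗ id : H ⊗ X → X`, the map occurring in the counit axioms. -/
def counitLeft : H ⊗[k] X →ₐ[k] X :=
  (Algebra.TensorProduct.lid k X).toAlgHom.comp (Algebra.TensorProduct.map ε (AlgHom.id k X))

/-- `id ⊗ ε : X ⊗ H → X`, the map occurring in the counit axioms. -/
def counitRight : X ⊗[k] H →ₐ[k] X :=
  (Algebra.TensorProduct.rid k k X).toAlgHom.comp (Algebra.TensorProduct.map (AlgHom.id k X) ε)

theorem counitLeft_tmul (h : H) (x : X) : counitLeft ε (h ⊗ₜ[k] x) = ε h • x := rfl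

theorem counitRight_tmul (x : X) (h : H) : counitRight ε (x ⊗ₜ[k] h) = ε h • x := rfl

theorem counitLeft_oneTensor (x : X) :
    counitLeft ε (oneTensor (k := k) (H := H) x) = x := by
  rw [oneTensor_apply, counitLeft_tmul, map_one, one_smul]

theorem coRight_counitLeft_tensorOne (t : H ⊗[k] H) :
    coRight (counitLeft ε) (tensorOne X t) = counitRight ε t ⊗ₜ 1 := by
  induction t with
  | zero => simp only [map_zero, TensorProduct.zero_tmul]
  | add s t hs ht => simp only [map_add, TensorProduct.add_tmul, hs, ht]
  | tmul g h =>
    rw [tensorOne_tmul, coRight_tmul, counitLeft_tmul, counitRight_tmul, TensorProduct.smul_tmul]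

theorem coRight_coRight_counitLeft_tensorOne₃ (t : H ⊗[k] (H ⊗[k] H)) :
    coRight (coRight (counitLeft ε)) (tensorOne₃ t) =
      tensorOne₂ (coRight (counitRight ε) t) := by
  have hε : (coRight (counitLeft ε)).comp tensorOne₂ =
      Algebra.TensorProduct.includeLeft.comp (counitRight ε) :=
    AlgHom.ext (coRight_counitLeft_tensorOne ε)
  rw [tensorOne₃, coRight_coRight, hε, ← coRight_coRight, tensorOne₂]

theorem coRight_counitRight_tensorOne₂ (t : H ⊗[k] H) :
    coRight (counitRight ε) (tensorOne₂ t) = t :=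
  coRight_coRight_of_leftInverse _ _
    (fun h => by
      rw [Algebra.TensorProduct.includeLeft_apply, counitRight_tmul, map_one, one_smul]) t

theorem coRight_counitLeft_coLeft {f : H →ₐ[k] H ⊗[k] H} (hf : ∀ h, counitRight ε (f h) = h)
    (t : H ⊗[k] X) : coRight (counitLeft ε) (coLeft X f t) = t := by
  induction t with
  | zero => simp only [map_zero]
  | add s t hs ht => simp only [map_add, hs, ht]
  | tmul h x =>
    rw [coLeft_tmul_eq_mul, map_mul, coRight_counitLeft_tensorOne, hf, coRight_oneTensor,
      counitLeft_oneTensor, oneTensor_apply, Algebra.TensorProduct.tmul_mul_tmul, mul_one, one_mul]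

end Counits

namespace QuasiBialgebraData

section Associator

variable {k H : Type*} [Field k] [Ring H] [Algebra k H]

namespace IsQuasiBialgebra

variable {Q : QuasiBialgebraData k H} (hQ : Q.IsQuasiBialgebra)
include hQ

theorem coRight_counitLeft_Φ : coRight (counitLeft Q.ε) (Q.Φ : H ⊗[k] (H ⊗[k] H)) = 1 :=
  hQ.counit_Φ

theorem coRight_counitLeft_coRight (t : H ⊗[k] H) :
    coRight (counitLeft Q.ε) (coRight Q.Δ t) = t :=
  coRight_coRight_of_leftInverse _ _ hQ.counit_left t

theorem coRight_counitLeft_coLeft {X : Type*} [Semiring X] [Algebra k X] (t : H ⊗[k] X) :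
    coRight (counitLeft Q.ε) (coLeft X Q.Δ t) = t :=
  QuasiSmash.coRight_counitLeft_coLeft Q.ε hQ.counit_right t

/-- Apply `id ⊗ id ⊗ ε ⊗ id` to the pentagon identity and cancel `Φ`. -/
theorem coRight_counitRight_Φ :
    coRight (counitRight Q.ε) (Q.Φ : H ⊗[k] (H ⊗[k] H)) = 1 := by
  have hpent := congrArg (coRight (coRight (counitLeft Q.ε))) hQ.pentagon
  simp only [map_mul] at hpent
  rw [coRight_oneTensor, hQ.coRight_counitLeft_Φ, map_one, one_mul,
    coRight_coRight_of_leftInverse _ _ hQ.coRight_counitLeft_coLeft,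
    coRight_coRight_of_leftInverse _ _ hQ.coRight_counitLeft_coRight,
    coRight_coRight_counitLeft_tensorOne₃, ← coLeft_coRight, hQ.coRight_counitLeft_Φ, map_one,
    mul_one] at hpent
  rw [← coRight_counitRight_tensorOne₂ Q.ε (coRight _ _), Q.Φ.isUnit.mul_eq_left.mp hpent, map_one]

theorem coRight_counitLeft_inv_Φ :
    coRight (counitLeft Q.ε) (↑Q.Φ⁻¹ : H ⊗[k] (H ⊗[k] H)) = 1 :=
  map_units_inv_eq_one hQ.coRight_counitLeft_Φ

theorem coRight_counitRight_inv_Φ :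
    coRight (counitRight Q.ε) (↑Q.Φ⁻¹ : H ⊗[k] (H ⊗[k] H)) = 1 :=
  map_units_inv_eq_one hQ.coRight_counitRight_Φ

theorem inv_quasi_coassoc (h : H) :
    coLeft H Q.Δ (Q.Δ h) * (↑Q.Φ⁻¹ : H ⊗[k] (H ⊗[k] H)) =
      (↑Q.Φ⁻¹ : H ⊗[k] (H ⊗[k] H)) * coRight Q.Δ (Q.Δ h) := by
  rw [Units.mul_inv_eq_iff_eq_mul, mul_assoc, hQ.quasi_coassoc, Units.inv_mul_cancel_left]

theorem inv_pentagon :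
    coLeft (H ⊗[k] H) Q.Δ (↑Q.Φ⁻¹ : H ⊗[k] (H ⊗[k] H)) *
        coRight (coRight Q.Δ) (↑Q.Φ⁻¹ : H ⊗[k] (H ⊗[k] H)) =
      tensorOne₃ (↑Q.Φ⁻¹ : H ⊗[k] (H ⊗[k] H)) *
        coRight (coLeft H Q.Δ) (↑Q.Φ⁻¹ : H ⊗[k] (H ⊗[k] H)) *
          oneTensor (↑Q.Φ⁻¹ : H ⊗[k] (H ⊗[k] H)) := by
  have hunits : unitsMap oneTensor Q.Φ * unitsMap (coRight (coLeft H Q.Δ)) Q.Φ *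
      unitsMap tensorOne₃ Q.Φ =
      unitsMap (coRight (coRight Q.Δ)) Q.Φ * unitsMap (coLeft (H ⊗[k] H) Q.Δ) Q.Φ :=
    Units.ext hQ.pentagon
  have hinv := congrArg Inv.inv hunits
  simp only [mul_inv_rev, ← map_inv, ← mul_assoc] at hinv
  exact (congrArg Units.val hinv).symm

theorem semiconjBy_Φ (h : H) :
    SemiconjBy (Q.Φ : H ⊗[k] (H ⊗[k] H)) (coLeft H Q.Δ (Q.Δ h)) (coRight Q.Δ (Q.Δ h)) :=
  (hQ.quasi_coassoc h).symm

theorem semiconjBy_oneTensor_Φ (t : H ⊗[k] H) :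
    SemiconjBy (oneTensor (Q.Φ : H ⊗[k] (H ⊗[k] H))) (coRight (coLeft H Q.Δ) (coRight Q.Δ t))
      (coRight (coRight Q.Δ) (coRight Q.Δ t)) := by
  rw [coRight_coRight, coRight_coRight]
  exact semiconjBy_coRight hQ.semiconjBy_Φ t

theorem semiconjBy_tensorOne₃_Φ (t : H ⊗[k] H) :
    SemiconjBy (tensorOne₃ (Q.Φ : H ⊗[k] (H ⊗[k] H))) (coLeft (H ⊗[k] H) Q.Δ (coLeft H Q.Δ t))
      (coRight (coLeft H Q.Δ) (coLeft H Q.Δ t)) := by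
  refine semiconjBy_of_tmul (f := (coLeft (H ⊗[k] H) Q.Δ).comp (coLeft H Q.Δ))
    (g := (coRight (coLeft H Q.Δ)).comp (coLeft H Q.Δ)) (fun g h => ?_) t
  have hsplit : coLeft H Q.Δ (g ⊗ₜ h) = tensorOne₂ (Q.Δ g) * oneTensor (oneTensor h) :=
    coLeft_tmul_eq_mul Q.Δ g h
  rw [AlgHom.comp_apply, AlgHom.comp_apply, hsplit, map_mul, map_mul, coRight_coLeft_tensorOne₂,
    coLeft_tensorOne₂, coRight_oneTensor, coLeft_oneTensor, coLeft_oneTensor]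
  exact ((hQ.semiconjBy_Φ g).map tensorOne₃).mul_right (commute_oneTensor_tensorOne₃ h _).symm

end IsQuasiBialgebra

end Associator

/-- The pentagon identity is stable under twisting, in group form. The subscripts are the tensor
legs, so that `φ₁_23_4` and `f₁_23` stand for `(id ⊗ Δ ⊗ id)(Φ)` and `(id ⊗ Δ)(F) ⊗ 1`; `p`, `p'`,
`q`, `q'` are the iterated coproducts `(id ⊗ (Δ ⊗ id)Δ)(F)`, `(id ⊗ (id ⊗ Δ)Δ)(F)`,
`((id ⊗ Δ)Δ ⊗ id)(F⁻¹)`, `((Δ ⊗ id)Δ ⊗ id)(F⁻¹)`. -/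
theorem pentagon_of_conj {G : Type*} [Group G]
    {f₁₂ f₂₃ f₃₄ f₁_23 f₁₂_3 f₂_34 f₂₃_4 f₁₂_34 p p' q q' φ₁₂₃ φ₂₃₄ φ₁_23_4 φ₁_2_34 φ₁₂_3_4 : G}
    (hf : Commute f₃₄ f₁₂) (hp : SemiconjBy φ₂₃₄ p p') (hq : SemiconjBy φ₁₂₃ q' q)
    (hφ : φ₂₃₄ * φ₁_23_4 * φ₁₂₃ = φ₁_2_34 * φ₁₂_3_4) :
    (f₃₄ * f₂_34 * φ₂₃₄ * f₂₃_4⁻¹ * f₂₃⁻¹) *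
        (f₂₃ * (f₂₃_4 * p * φ₁_23_4 * q * f₁_23⁻¹) * f₂₃⁻¹) *
        (f₂₃ * f₁_23 * φ₁₂₃ * f₁₂_3⁻¹ * f₁₂⁻¹) =
      (f₃₄ * (f₂_34 * p' * φ₁_2_34 * f₁₂_34⁻¹ * f₁₂⁻¹) * f₃₄⁻¹) *
        (f₁₂ * (f₃₄ * f₁₂_34 * φ₁₂_3_4 * q' * f₁₂_3⁻¹) * f₁₂⁻¹) := by
  have hf' : f₁₂⁻¹ * (f₃₄⁻¹ * (f₁₂ * f₃₄)) = 1 := by rw [← hf.eq]; group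
  calc _ = f₃₄ * f₂_34 * (φ₂₃₄ * p) * φ₁_23_4 * (q * φ₁₂₃) * f₁₂_3⁻¹ * f₁₂⁻¹ := by group
    _ = f₃₄ * f₂_34 * p' * (φ₂₃₄ * φ₁_23_4 * φ₁₂₃) * q' * f₁₂_3⁻¹ * f₁₂⁻¹ := by
      rw [hp.eq, ← hq.eq]; group
    _ = f₃₄ * f₂_34 * p' * φ₁_2_34 * f₁₂_34⁻¹ * (f₁₂⁻¹ * (f₃₄⁻¹ * (f₁₂ * f₃₄))) * f₁₂_34 *
        φ₁₂_3_4 * q' * f₁₂_3⁻¹ * f₁₂⁻¹ := by rw [hf', hφ]; group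
    _ = _ := by group

section Twist

variable {k H : Type*} [Field k] [Ring H] [Algebra k H] (Q : QuasiBialgebraData k H)
  (F : (H ⊗[k] H)ˣ)

theorem twist_Δ (h : H) : (Q.twist F).Δ h = F * Q.Δ h * (↑F⁻¹ : H ⊗[k] H) := rfl

theorem twist_Φ : ((Q.twist F).Φ : H ⊗[k] (H ⊗[k] H)) =
    oneTensor (F : H ⊗[k] H) * coRight Q.Δ (F : H ⊗[k] H) * (Q.Φ : H ⊗[k] (H ⊗[k] H)) *
      coLeft H Q.Δ (↑F⁻¹ : H ⊗[k] H) * tensorOne₂ (↑F⁻¹ : H ⊗[k] H) := rfl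

theorem twist_inv_Φ : (↑(Q.twist F).Φ⁻¹ : H ⊗[k] (H ⊗[k] H)) =
    tensorOne₂ (F : H ⊗[k] H) * coLeft H Q.Δ (F : H ⊗[k] H) * (↑Q.Φ⁻¹ : H ⊗[k] (H ⊗[k] H)) *
      coRight Q.Δ (↑F⁻¹ : H ⊗[k] H) * oneTensor (↑F⁻¹ : H ⊗[k] H) := by
  rw [twist]
  simp only [mul_inv_rev, ← map_inv, inv_inv, Units.val_mul, mul_assoc]
  rfl

theorem coRight_twist (t : H ⊗[k] H) :
    coRight (Q.twist F).Δ t =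
      oneTensor (F : H ⊗[k] H) * coRight Q.Δ t * oneTensor (↑F⁻¹ : H ⊗[k] H) :=
  coRight_conj (Q.twist_Δ F) t

theorem coLeft_twist {X : Type*} [Semiring X] [Algebra k X] (t : H ⊗[k] X) :
    coLeft X (Q.twist F).Δ t =
      tensorOne X (F : H ⊗[k] H) * coLeft X Q.Δ t * tensorOne X (↑F⁻¹ : H ⊗[k] H) := by
  induction t with
  | zero => simp only [map_zero, mul_zero, zero_mul]
  | add s t hs ht => simp only [map_add, mul_add, add_mul, hs, ht]
  | tmul h x =>
    rw [coLeft_tmul_eq_mul, coLeft_tmul_eq_mul, twist_Δ, map_mul, map_mul, mul_assoc,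
      ← (commute_oneTensor_tensorOne x _).eq]
    simp only [mul_assoc]

theorem coRight_coLeft_twist (t : H ⊗[k] (H ⊗[k] H)) :
    coRight (coLeft H (Q.twist F).Δ) t =
      oneTensor (tensorOne₂ (F : H ⊗[k] H)) * coRight (coLeft H Q.Δ) t *
        oneTensor (tensorOne₂ (↑F⁻¹ : H ⊗[k] H)) :=
  coRight_conj (Q.coLeft_twist F) t

theorem coRight_coRight_twist (t : H ⊗[k] (H ⊗[k] H)) :
    coRight (coRight (Q.twist F).Δ) t =
      oneTensor (oneTensor (F : H ⊗[k] H)) * coRight (coRight Q.Δ) t *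
        oneTensor (oneTensor (↑F⁻¹ : H ⊗[k] H)) :=
  coRight_conj (Q.coRight_twist F) t

end Twist

section Gauge

variable {k H : Type*} [Field k] [Ring H] [Algebra k H] {Q : QuasiBialgebraData k H}
  {F : (H ⊗[k] H)ˣ}

theorem IsGauge.counitLeft_eq_one (hF : Q.IsGauge F) : counitLeft Q.ε (F : H ⊗[k] H) = 1 :=
  hF.counit_left

theorem IsGauge.counitRight_eq_one (hF : Q.IsGauge F) : counitRight Q.ε (F : H ⊗[k] H) = 1 :=
  hF.counit_right

theorem IsGauge.inv (hF : Q.IsGauge F) : Q.IsGauge F⁻¹ where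
  counit_left := map_units_inv_eq_one hF.counitLeft_eq_one
  counit_right := map_units_inv_eq_one hF.counitRight_eq_one

namespace IsQuasiBialgebra

variable (hQ : Q.IsQuasiBialgebra)
include hQ

theorem twist_quasi_coassoc (h : H) :
    coRight (Q.twist F).Δ ((Q.twist F).Δ h) * (Q.twist F).Φ =
      (Q.twist F).Φ * coLeft H (Q.twist F).Δ ((Q.twist F).Δ h) := by
  have hleft := Q.coLeft_twist F ((Q.twist F).Δ h)
  change _ = tensorOne₂ (F : H ⊗[k] H) * _ * tensorOne₂ (↑F⁻¹ : H ⊗[k] H) at hleft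
  rw [coRight_twist, hleft, twist_Φ]
  simp only [twist_Δ, map_mul, mul_assoc, map_units_inv_mul_cancel]
  rw [← mul_assoc (coRight Q.Δ (Q.Δ h)), hQ.quasi_coassoc]
  simp only [mul_assoc]

theorem twist_pentagon :
    oneTensor (k := k) (H := H) ((Q.twist F).Φ : H ⊗[k] (H ⊗[k] H)) *
        coRight (coLeft H (Q.twist F).Δ) (Q.twist F).Φ * tensorOne₃ (Q.twist F).Φ =
      coRight (coRight (Q.twist F).Δ) ((Q.twist F).Φ : H ⊗[k] (H ⊗[k] H)) *
        coLeft (H ⊗[k] H) (Q.twist F).Δ (Q.twist F).Φ := by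
  have hconj := congrArg Units.val (pentagon_of_conj (G := (H ⊗[k] (H ⊗[k] (H ⊗[k] H)))ˣ)
    (f₁₂ := unitsMap (tensorOne (H ⊗[k] H)) F)
    (f₂₃ := unitsMap oneTensor (unitsMap tensorOne₂ F))
    (f₃₄ := unitsMap oneTensor (unitsMap oneTensor F))
    (f₁_23 := unitsMap tensorOne₃ (unitsMap (coRight Q.Δ) F))
    (f₁₂_3 := unitsMap tensorOne₃ (unitsMap (coLeft H Q.Δ) F))
    (f₂_34 := unitsMap oneTensor (unitsMap (coRight Q.Δ) F))
    (f₂₃_4 := unitsMap oneTensor (unitsMap (coLeft H Q.Δ) F))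
    (f₁₂_34 := unitsMap (coLeft (H ⊗[k] H) Q.Δ) (unitsMap (coRight Q.Δ) F))
    (p := unitsMap (coRight (coLeft H Q.Δ)) (unitsMap (coRight Q.Δ) F))
    (p' := unitsMap (coRight (coRight Q.Δ)) (unitsMap (coRight Q.Δ) F))
    (q := unitsMap (coRight (coLeft H Q.Δ)) (unitsMap (coLeft H Q.Δ) F⁻¹))
    (q' := unitsMap (coLeft (H ⊗[k] H) Q.Δ) (unitsMap (coLeft H Q.Δ) F⁻¹))
    (φ₁₂₃ := unitsMap tensorOne₃ Q.Φ) (φ₂₃₄ := unitsMap oneTensor Q.Φ)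
    (φ₁_23_4 := unitsMap (coRight (coLeft H Q.Δ)) Q.Φ)
    (φ₁_2_34 := unitsMap (coRight (coRight Q.Δ)) Q.Φ)
    (φ₁₂_3_4 := unitsMap (coLeft (H ⊗[k] H) Q.Δ) Q.Φ)
    (Units.ext (commute_oneTensor_tensorOne _ _).eq)
    (Units.ext (hQ.semiconjBy_oneTensor_Φ _)) (Units.ext (hQ.semiconjBy_tensorOne₃_Φ _))
    (Units.ext hQ.pentagon))
  simp only [Units.val_mul, ← map_inv, val_unitsMap] at hconj
  have htensorOne : coRight (coRight Q.Δ) (tensorOne₂ (↑F⁻¹ : H ⊗[k] H)) =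
      tensorOne (H ⊗[k] H) (↑F⁻¹ : H ⊗[k] H) :=
    coRight_coRight_tensorOne Q.Δ _
  rw [coRight_coLeft_twist, coRight_coRight_twist, coLeft_twist, twist_Φ]
  simp only [map_mul, coRight_oneTensor, coLeft_oneTensor, coRight_coLeft_tensorOne₂,
    coLeft_tensorOne₂, htensorOne, tensorOne₃_tensorOne₂, tensorOne₃_oneTensor, ← coLeft_coRight]
  exact hconj

theorem twist (hF : Q.IsGauge F) : (Q.twist F).IsQuasiBialgebra where
  quasi_coassoc := hQ.twist_quasi_coassoc
  counit_left h := by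
    change counitLeft Q.ε ((F : H ⊗[k] H) * Q.Δ h * (↑F⁻¹ : H ⊗[k] H)) = h
    rw [map_mul, map_mul, hF.counitLeft_eq_one, hF.inv.counitLeft_eq_one, one_mul, mul_one]
    exact hQ.counit_left h
  counit_right h := by
    change counitRight Q.ε ((F : H ⊗[k] H) * Q.Δ h * (↑F⁻¹ : H ⊗[k] H)) = h
    rw [map_mul, map_mul, hF.counitRight_eq_one, hF.inv.counitRight_eq_one, one_mul, mul_one]
    exact hQ.counit_right h
  pentagon := hQ.twist_pentagon
  counit_Φ := by
    have hF₂ : coRight (counitLeft Q.ε) (tensorOne₂ (↑F⁻¹ : H ⊗[k] H)) = 1 := by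
      refine (coRight_counitLeft_tensorOne Q.ε _).trans ?_
      rw [hF.inv.counitRight_eq_one, Algebra.TensorProduct.one_def]
    change coRight (counitLeft Q.ε) _ = 1
    rw [twist_Φ, map_mul, map_mul, map_mul, map_mul, coRight_oneTensor, hF.counitLeft_eq_one,
      hQ.coRight_counitLeft_coRight, hQ.coRight_counitLeft_Φ, hQ.coRight_counitLeft_coLeft, hF₂,
      map_one, one_mul, mul_one, mul_one, Units.mul_inv]

end IsQuasiBialgebra

end Gauge

end QuasiBialgebraData

/-! ### Module algebras and smash products -/

namespace ModuleAlgebraData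

variable {k H B M N : Type*} [Field k] [Ring H] [Algebra k H] [AddCommGroup B] [Module k B]
  [Semiring M] [Algebra k M] [Semiring N] [Algebra k N]

section

variable (D : ModuleAlgebraData k H B)

/-- `m ⊗ n ↦ φ(m) ψ(n)`, with the multiplication of `B`; `mulAct b b'` and `mulAct₃ b b' b''` are
instances of this construction. -/
def mulMap (φ : M →ₗ[k] B) (ψ : N →ₗ[k] B) : M ⊗[k] N →ₗ[k] B :=
  TensorProduct.lift D.mul ∘ₗ TensorProduct.map φ ψ

theorem mulMap_tmul (φ : M →ₗ[k] B) (ψ : N →ₗ[k] B) (m : M) (n : N) :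
    D.mulMap φ ψ (m ⊗ₜ n) = D.mul (φ m) (ψ n) := rfl

theorem mulMap_act_act (b b' : B) : D.mulMap (D.act b) (D.act b') = D.mulAct b b' := rfl

theorem mulMap_act_mulAct (b b' b'' : B) :
    D.mulMap (D.act b) (D.mulAct b' b'') = D.mulAct₃ b b' b'' := rfl

/-- `φ : M → B` is `H`-linear when `H` acts on `M` by right multiplication through the algebra map
`f : H → M`. This treats the orbit maps `b · -` and `(b · -)(b' · -)` on a par. -/
def IsEquivariant (f : H →ₐ[k] M) (φ : M →ₗ[k] B) : Prop :=
  ∀ (m : M) (h : H), D.act (φ m) h = φ (m * f h)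

end

theorem legAct_eq_lTensor (D : ModuleAlgebraData k H B) (T : H ⊗[k] H) (b : B) :
    D.legAct T b = (D.act b).lTensor H T := rfl

theorem smul_lTensor (φ : M →ₗ[k] B) (a : H) (t : H ⊗[k] M) :
    a • φ.lTensor H t = φ.lTensor H ((a ⊗ₜ 1) * t) := by
  induction t with
  | zero => simp only [mul_zero, map_zero, smul_zero]
  | add s t hs ht => simp only [mul_add, map_add, smul_add, hs, ht]
  | tmul h m =>
    rw [Algebra.TensorProduct.tmul_mul_tmul, one_mul, LinearMap.lTensor_tmul,
      LinearMap.lTensor_tmul, TensorProduct.smul_tmul', smul_eq_mul]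

theorem lTensor_mulRight (x : M) (t : H ⊗[k] M) :
    (LinearMap.mulRight k x).lTensor H t = t * oneTensor x := by
  induction t with
  | zero => simp only [map_zero, zero_mul]
  | add s t hs ht => simp only [map_add, add_mul, hs, ht]
  | tmul h m =>
    rw [LinearMap.lTensor_tmul, LinearMap.mulRight_apply, oneTensor_apply,
      Algebra.TensorProduct.tmul_mul_tmul, mul_one]

section Equivariant

variable {D : ModuleAlgebraData k H B} {f : H →ₐ[k] M} {g : H →ₐ[k] N} {φ : M →ₗ[k] B}
  {ψ : N →ₗ[k] B}

namespace IsEquivariant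

theorem mulAct_apply (hφ : D.IsEquivariant f φ) (hψ : D.IsEquivariant g ψ) (m : M) (n : N)
    (t : H ⊗[k] H) :
    D.mulAct (φ m) (ψ n) t = D.mulMap φ ψ ((m ⊗ₜ n) * Algebra.TensorProduct.map f g t) := by
  induction t with
  | zero => simp only [map_zero, mul_zero]
  | add s t hs ht => simp only [map_add, mul_add, hs, ht]
  | tmul h h' =>
    rw [mulAct_tmul, hφ, hψ, Algebra.TensorProduct.map_tmul,
      Algebra.TensorProduct.tmul_mul_tmul, mulMap_tmul]

theorem ext₁_legAct (hφ : D.IsEquivariant f φ) (S : H ⊗[k] M) (T : H ⊗[k] H) :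
    ext₁ (D.legAct T) (φ.lTensor H S) = φ.lTensor H (S * coRight f T) := by
  induction S with
  | zero => simp only [map_zero, zero_mul]
  | add S S' hS hS' => simp only [map_add, add_mul, hS, hS']
  | tmul h m =>
    rw [LinearMap.lTensor_tmul, ext₁_tmul]
    induction T with
    | zero => simp only [map_zero, mul_zero, smul_zero, legAct_eq_lTensor]
    | add T T' hT hT' =>
      simp only [map_add, mul_add, smul_add, legAct_eq_lTensor] at hT hT' ⊢
      rw [hT, hT']
    | tmul g h' =>
      rw [legAct_tmul, coRight_tmul, Algebra.TensorProduct.tmul_mul_tmul, LinearMap.lTensor_tmul,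
        hφ, TensorProduct.smul_tmul', smul_eq_mul]

theorem lTensor_mulAct (hφ : D.IsEquivariant f φ) (hψ : D.IsEquivariant g ψ) (m : M) (n : N)
    (t : H ⊗[k] (H ⊗[k] H)) :
    (D.mulAct (φ m) (ψ n)).lTensor H t = (D.mulMap φ ψ).lTensor H
      (oneTensor (m ⊗ₜ n) * coRight (Algebra.TensorProduct.map f g) t) := by
  induction t with
  | zero => simp only [map_zero, mul_zero]
  | add s t hs ht => simp only [map_add, mul_add, hs, ht]
  | tmul h t =>
    rw [LinearMap.lTensor_tmul, hφ.mulAct_apply hψ, coRight_tmul, oneTensor_apply,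
      Algebra.TensorProduct.tmul_mul_tmul, one_mul, LinearMap.lTensor_tmul]

theorem ext₂_smashσ (hφ : D.IsEquivariant f φ) (hψ : D.IsEquivariant g ψ)
    (Q : QuasiBialgebraData k H) (T : H ⊗[k] M) (n : N) :
    ext₂ (D.smashσ Q) (φ.lTensor H T ⊗ₜ ψ n) = (D.mulMap φ ψ).lTensor H
      (tensorOne N T * oneTensor (1 ⊗ₜ n) * coRight (Algebra.TensorProduct.map f g)
        (↑Q.Φ⁻¹ : H ⊗[k] (H ⊗[k] H))) := by
  induction T with
  | zero => simp only [map_zero, TensorProduct.zero_tmul, zero_mul]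
  | add T T' hT hT' => simp only [map_add, TensorProduct.add_tmul, add_mul, hT, hT']
  | tmul h m =>
    rw [LinearMap.lTensor_tmul, ext₂_tmul, smashσ_tmul, hφ.lTensor_mulAct hψ, smul_lTensor,
      ← mul_assoc]
    simp only [tensorOne_tmul, oneTensor_apply, Algebra.TensorProduct.tmul_mul_tmul, one_mul,
      mul_one]

end IsEquivariant

theorem ext₂_smashR (Q : QuasiBialgebraData k H) (x : H ⊗[k] B) (h : H) :
    ext₂ (D.smashR Q) (x ⊗ₜ h) = ext₁ (D.legAct (Q.Δ h)) x := by
  induction x with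
  | zero => simp only [TensorProduct.zero_tmul, map_zero]
  | add x y hx hy => simp only [TensorProduct.add_tmul, map_add, hx, hy]
  | tmul a b => rw [ext₂_tmul, ext₁_tmul, smashR_tmul]

end Equivariant

namespace IsModuleAlgebra

variable {D : ModuleAlgebraData k H B} {Q : QuasiBialgebraData k H} (hD : D.IsModuleAlgebra Q)
include hD

theorem isEquivariant_act (b : B) : D.IsEquivariant (AlgHom.id k H) (D.act b) :=
  fun m h => (hD.act_mul b m h).symm

theorem legAct_one (b : B) : D.legAct 1 b = 1 ⊗ₜ b := by
  rw [Algebra.TensorProduct.one_def, legAct_tmul, hD.act_one]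

theorem ext₁_legAct_legAct (S T : H ⊗[k] H) (b : B) :
    ext₁ (D.legAct T) (D.legAct S b) = D.legAct (S * T) b := by
  rw [legAct_eq_lTensor, (hD.isEquivariant_act b).ext₁_legAct, coRight_id,
    AlgHom.id_apply, legAct_eq_lTensor]

theorem mulAct_act_act (b b' : B) (h h' : H) (t : H ⊗[k] H) :
    D.mulAct (D.act b h) (D.act b' h') t = D.mulAct b b' ((h ⊗ₜ h') * t) := by
  rw [(hD.isEquivariant_act b).mulAct_apply (hD.isEquivariant_act b'),
    Algebra.TensorProduct.map_id, AlgHom.id_apply, mulMap_act_act]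

theorem isEquivariant_mulAct (b b' : B) : D.IsEquivariant Q.Δ (D.mulAct b b') := fun t h => by
  induction t with
  | zero => simp only [map_zero, zero_mul, LinearMap.zero_apply]
  | add s t hs ht => simp only [map_add, add_mul, LinearMap.add_apply, hs, ht]
  | tmul g g' => rw [mulAct_tmul, hD.mul_act, hD.mulAct_act_act]

theorem mulAct₃_act_act_act (b b' b'' : B) (f g h : H) (t : H ⊗[k] (H ⊗[k] H)) :
    D.mulAct₃ (D.act b f) (D.act b' g) (D.act b'' h) t =
      D.mulAct₃ b b' b'' ((f ⊗ₜ (g ⊗ₜ h)) * t) := by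
  induction t with
  | zero => simp only [map_zero, mul_zero]
  | add s t hs ht => simp only [map_add, mul_add, hs, ht]
  | tmul a t =>
    rw [← mulMap_act_mulAct, mulMap_tmul, hD.mulAct_act_act, ← hD.act_mul,
      Algebra.TensorProduct.tmul_mul_tmul, ← mulMap_act_mulAct, mulMap_tmul]

theorem mulMap_mulAct_act (b b' b'' : B) :
    D.mulMap (D.mulAct b b') (D.act b'') = D.mulAct₃ b b' b'' ∘ₗ
      LinearMap.mulRight k (↑Q.Φ⁻¹ : H ⊗[k] (H ⊗[k] H)) ∘ₗ
        (Algebra.TensorProduct.assoc k k k H H H).toAlgHom.toLinearMap :=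
  TensorProduct.ext_threefold fun f g h => by
    rw [mulMap_tmul, mulAct_tmul, hD.quasi_assoc, hD.mulAct₃_act_act_act]
    rfl

theorem legAct_apply_one (T : H ⊗[k] H) : D.legAct T D.one = counitRight Q.ε T ⊗ₜ D.one := by
  rw [legAct_eq_lTensor]
  induction T with
  | zero => simp only [map_zero, TensorProduct.zero_tmul]
  | add S T hS hT => simp only [map_add, TensorProduct.add_tmul, hS, hT]
  | tmul g h =>
    rw [LinearMap.lTensor_tmul, hD.one_act, counitRight_tmul, TensorProduct.smul_tmul]

theorem mulAct_one_left (b : B) :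
    D.mulAct D.one b = D.act b ∘ₗ (counitLeft Q.ε).toLinearMap :=
  TensorProduct.ext' fun g h => by
    rw [mulAct_tmul, hD.one_act, map_smul, LinearMap.smul_apply, hD.one_mul, LinearMap.comp_apply,
      AlgHom.toLinearMap_apply, counitLeft_tmul, map_smul]

theorem mulAct_one_right (b : B) :
    D.mulAct b D.one = D.act b ∘ₗ (counitRight Q.ε).toLinearMap :=
  TensorProduct.ext' fun g h => by
    rw [mulAct_tmul, hD.one_act, map_smul, hD.mul_one, LinearMap.comp_apply,
      AlgHom.toLinearMap_apply, counitRight_tmul, map_smul]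

theorem smashσ_eq_one_tmul {f : H ⊗[k] H →ₐ[k] H} {b b' c : B}
    (hc : D.mulAct b b' = D.act c ∘ₗ f.toLinearMap)
    (hf : coRight f (↑Q.Φ⁻¹ : H ⊗[k] (H ⊗[k] H)) = 1) :
    D.smashσ Q (b ⊗ₜ b') = 1 ⊗ₜ c := by
  rw [smashσ_tmul, hc, LinearMap.lTensor_comp_apply]
  change (D.act c).lTensor H (coRight f _) = _
  rw [hf, ← legAct_eq_lTensor, hD.legAct_one]

theorem crossedMul_legAct {g : H →ₐ[k] N} {ψ : N →ₗ[k] B} (hψ : D.IsEquivariant g ψ)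
    (T : H ⊗[k] H) (b : B) (S : H ⊗[k] N) :
    crossedMul (D.smashR Q) (D.smashσ Q) (D.legAct T b) (ψ.lTensor H S) =
      (D.mulMap (D.act b) ψ).lTensor H (tensorOne N T * coLeft N Q.Δ S *
        coRight (coRight g) (↑Q.Φ⁻¹ : H ⊗[k] (H ⊗[k] H))) := by
  induction S with
  | zero => simp only [map_zero, mul_zero, zero_mul]
  | add S S' hS hS' => simp only [map_add, mul_add, add_mul, hS, hS']
  | tmul h n =>
    rw [LinearMap.lTensor_tmul, crossedMul_tmul, ext₂_smashR, hD.ext₁_legAct_legAct,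
      legAct_eq_lTensor, (hD.isEquivariant_act b).ext₂_smashσ hψ, coLeft_tmul_eq_mul,
      map_mul (tensorOne N), mul_assoc (tensorOne N T)]
    rfl

theorem crossedMul_legAct_legAct (S T : H ⊗[k] H) (b b' : B) :
    crossedMul (D.smashR Q) (D.smashσ Q) (D.legAct S b) (D.legAct T b') =
      (D.mulAct b b').lTensor H
        (tensorOne₂ S * coLeft H Q.Δ T * (↑Q.Φ⁻¹ : H ⊗[k] (H ⊗[k] H))) := by
  rw [legAct_eq_lTensor D T, hD.crossedMul_legAct (hD.isEquivariant_act b'),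
    coRight_id, coRight_id, AlgHom.id_apply]
  rfl

theorem smashR_mul (b : B) (h h' : H) :
    D.smashR Q (b ⊗ₜ (h * h')) = ext₂ (D.smashR Q) (D.smashR Q (b ⊗ₜ h) ⊗ₜ h') := by
  rw [ext₂_smashR, smashR_tmul, smashR_tmul, hD.ext₁_legAct_legAct, map_mul]

theorem ext₂_smashσ_smashσ (u v w : B) :
    ext₂ (D.smashσ Q) (D.smashσ Q (u ⊗ₜ v) ⊗ₜ w) = (D.mulAct₃ u v w).lTensor H
      (tensorOne₃ (↑Q.Φ⁻¹ : H ⊗[k] (H ⊗[k] H)) *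
        coRight (coLeft H Q.Δ) (↑Q.Φ⁻¹ : H ⊗[k] (H ⊗[k] H)) *
          oneTensor (↑Q.Φ⁻¹ : H ⊗[k] (H ⊗[k] H))) := by
  conv_lhs => rw [smashσ_tmul, ← hD.act_one w]
  rw [(hD.isEquivariant_mulAct u v).ext₂_smashσ (hD.isEquivariant_act w), hD.mulMap_mulAct_act,
    LinearMap.lTensor_comp_apply, LinearMap.lTensor_comp_apply, lTensor_mulRight,
    ← Algebra.TensorProduct.one_def, map_one, _root_.mul_one]
  change (D.mulAct₃ u v w).lTensor H (coRight _ _ * _) = _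
  rw [map_mul (coRight _), coRight_assoc_tensorOne, coRight_coRight, coLeft]

theorem smashσ_cocycle (hQ : Q.IsQuasiBialgebra) (u v w : B) :
    crossedMul (D.smashR Q) (D.smashσ Q) (1 ⊗ₜ u) (D.smashσ Q (v ⊗ₜ w)) =
      ext₂ (D.smashσ Q) (D.smashσ Q (u ⊗ₜ v) ⊗ₜ w) := by
  rw [hD.ext₂_smashσ_smashσ, ← hQ.inv_pentagon, smashσ_tmul, ← hD.legAct_one,
    hD.crossedMul_legAct (hD.isEquivariant_mulAct v w), map_one, _root_.one_mul,
    mulMap_act_mulAct]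

theorem smash_twisted_module (hQ : Q.IsQuasiBialgebra) (u v : B) (h : H) :
    crossedMul (D.smashR Q) (D.smashσ Q) (1 ⊗ₜ u) (D.smashR Q (v ⊗ₜ h)) =
      ext₂ (D.smashR Q) (D.smashσ Q (u ⊗ₜ v) ⊗ₜ h) := by
  rw [smashR_tmul, ← hD.legAct_one, hD.crossedMul_legAct_legAct, map_one, _root_.one_mul,
    hQ.inv_quasi_coassoc, ext₂_smashR, smashσ_tmul, (hD.isEquivariant_mulAct u v).ext₁_legAct]

theorem isCrossedProduct (hQ : Q.IsQuasiBialgebra) :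
    IsCrossedProduct D.one (D.smashR Q) (D.smashσ Q) where
  R_one_left h := by
    rw [smashR_tmul, hD.legAct_apply_one]
    exact congrArg (· ⊗ₜ D.one) (hQ.counit_right h)
  R_one_right b := by rw [smashR_tmul, map_one, hD.legAct_one]
  σ_one_left b := hD.smashσ_eq_one_tmul (hD.mulAct_one_left b) hQ.coRight_counitLeft_inv_Φ
  σ_one_right b := hD.smashσ_eq_one_tmul (hD.mulAct_one_right b) hQ.coRight_counitRight_inv_Φ
  R_mul := TensorProduct.ext_threefold' fun b h h' => hD.smashR_mul b h h'
  σ_cocycle := TensorProduct.ext_threefold' fun u v w =>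
    (crossedMul_one_tmul_left _ _ u _).symm.trans (hD.smashσ_cocycle hQ u v w)
  twisted_module := TensorProduct.ext_threefold' fun u v h =>
    (crossedMul_one_tmul_left _ _ u _).symm.trans (hD.smash_twisted_module hQ u v h)

theorem smashMul_eq_crossedMul :
    D.smashMul Q = crossedMul (D.smashR Q) (D.smashσ Q) := by
  have hlegAct (h : H) (b : B) : h ⊗ₜ b = D.legAct (h ⊗ₜ 1) b := by
    rw [legAct_tmul, hD.act_one]
  refine TensorProduct.ext' fun h b => TensorProduct.ext' fun h' b' => ?_
  rw [smashMul_tmul, hlegAct h b, hlegAct h' b', hD.crossedMul_legAct_legAct, coLeft_tmul_eq_mul,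
    map_one, map_one, _root_.mul_one]
  rfl

section Twist

variable {F : (H ⊗[k] H)ˣ}

theorem mulAct_twist (T : H ⊗[k] H) (b b' : B) :
    (D.twist T).mulAct b b' = D.mulAct b b' ∘ₗ LinearMap.mulRight k T :=
  TensorProduct.ext' fun g h => hD.mulAct_act_act b b' g h T

theorem mulAct₃_twist (T : H ⊗[k] H) (b b' b'' : B) (t : H ⊗[k] (H ⊗[k] H)) :
    (D.twist T).mulAct₃ b b' b'' t = D.mulAct₃ b b' b'' (t * oneTensor T * coRight Q.Δ T) := by
  induction t with
  | zero => simp only [map_zero, zero_mul]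
  | add s t hs ht => simp only [map_add, add_mul, hs, ht]
  | tmul h t =>
    change D.mulAct (D.act b h) ((D.twist T).mulAct b' b'' t) T = _
    rw [hD.mulAct_twist, LinearMap.comp_apply, LinearMap.mulRight_apply,
      (hD.isEquivariant_act b).mulAct_apply (hD.isEquivariant_mulAct b' b''), oneTensor_apply,
      Algebra.TensorProduct.tmul_mul_tmul, _root_.mul_one]
    rfl

theorem twist_mul_twist_mul (T : H ⊗[k] H) (b b' b'' : B) :
    (D.twist T).mul ((D.twist T).mul b b') b'' = D.mulAct₃ b b' b''
      (tensorOne₂ T * coLeft H Q.Δ T * (↑Q.Φ⁻¹ : H ⊗[k] (H ⊗[k] H))) := by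
  rw [twist_mul, twist_mul]
  nth_rw 1 [← hD.act_one b'']
  rw [(hD.isEquivariant_mulAct b b').mulAct_apply (hD.isEquivariant_act b''),
    hD.mulMap_mulAct_act, LinearMap.comp_apply, LinearMap.comp_apply, LinearMap.mulRight_apply,
    AlgHom.toLinearMap_apply, map_mul (AlgEquiv.toAlgHom _), ← assoc_tmul_one]
  rfl

theorem twist (hF : Q.IsGauge F) : (D.twist F).IsModuleAlgebra (Q.twist F) where
  act_one := hD.act_one
  act_mul := hD.act_mul
  one_mul b := by
    rw [twist_mul]
    change D.mulAct D.one b _ = b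
    rw [hD.mulAct_one_left, LinearMap.comp_apply, AlgHom.toLinearMap_apply, hF.counitLeft_eq_one,
      hD.act_one]
  mul_one b := by
    rw [twist_mul]
    change D.mulAct b D.one _ = b
    rw [hD.mulAct_one_right, LinearMap.comp_apply, AlgHom.toLinearMap_apply, hF.counitRight_eq_one,
      hD.act_one]
  mul_act b b' h := by
    rw [hD.mulAct_twist, LinearMap.comp_apply, LinearMap.mulRight_apply, Q.twist_Δ,
      Units.inv_mul_cancel_right, ← hD.isEquivariant_mulAct]
    rfl
  one_act := hD.one_act
  quasi_assoc b b' b'' := by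
    rw [hD.twist_mul_twist_mul, hD.mulAct₃_twist, Q.twist_inv_Φ]
    simp only [mul_assoc, map_units_inv_mul_cancel]
    rw [← map_mul (coRight Q.Δ), Units.inv_mul, map_one, _root_.mul_one]

theorem twistedR_eq :
    twistedR (D.smashR Q) (D.legAct F) (D.legAct (↑F⁻¹ : H ⊗[k] H)) =
      (D.twist F).smashR (Q.twist F) :=
  TensorProduct.ext' fun b h => by
    change ext₁ _ (ext₂ (D.smashR Q) (D.legAct F b ⊗ₜ h)) = D.legAct ((Q.twist F).Δ h) b
    rw [ext₂_smashR, hD.ext₁_legAct_legAct, hD.ext₁_legAct_legAct, Q.twist_Δ]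

theorem twistedσ_eq :
    twistedσ (D.smashR Q) (D.smashσ Q) (D.legAct F) (D.legAct (↑F⁻¹ : H ⊗[k] H)) =
      (D.twist F).smashσ (Q.twist F) :=
  TensorProduct.ext' fun b b' => by
    change ext₁ _ (crossedMul (D.smashR Q) (D.smashσ Q) (D.legAct F b) (D.legAct F b')) = _
    rw [hD.crossedMul_legAct_legAct, (hD.isEquivariant_mulAct b b').ext₁_legAct, smashσ_tmul,
      hD.mulAct_twist, LinearMap.lTensor_comp_apply, lTensor_mulRight, Q.twist_inv_Φ]
    simp only [mul_assoc, ← map_mul, Units.inv_mul, map_one, _root_.mul_one]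

theorem isTwistingPair (hQ : Q.IsQuasiBialgebra) (hF : Q.IsGauge F) :
    IsTwistingPair D.one (D.smashR Q) (D.smashσ Q) (D.legAct F) (D.legAct (↑F⁻¹ : H ⊗[k] H)) :=
  (hD.isCrossedProduct hQ).isTwistingPair
    (by rw [hD.legAct_apply_one, hF.counitRight_eq_one])
    (by rw [hD.legAct_apply_one, hF.inv.counitRight_eq_one])
    (fun b => by rw [hD.ext₁_legAct_legAct, Units.mul_inv, hD.legAct_one])
    (fun b => by rw [hD.ext₁_legAct_legAct, Units.inv_mul, hD.legAct_one])

end Twist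

end IsModuleAlgebra

theorem ext₁_legAct_tmul (D : ModuleAlgebraData k H B) (T : H ⊗[k] H) (h : H) (b : B) :
    ext₁ (D.legAct T) (h ⊗ₜ b) = (D.act b).lTensor H ((h ⊗ₜ 1) * T) := by
  rw [ext₁_tmul, legAct_eq_lTensor, smul_lTensor]

end ModuleAlgebraData

end QuasiSmash

end

open QuasiSmash in
theorem proposition2p3 {k H B : Type*} [Field k] [Ring H] [Algebra k H]
    [AddCommGroup B] [Module k B]
    (Q : QuasiBialgebraData k H) (hQ : Q.IsQuasiBialgebra)
    (F : (H ⊗[k] H)ˣ) (hF : Q.IsGauge F)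
    (D : ModuleAlgebraData k H B) (hD : D.IsModuleAlgebra Q) :
    -- `H_F` is a quasi-bialgebra and `_F B` is a right `H_F`-module algebra
    (Q.twist F).IsQuasiBialgebra ∧
    (D.twist F).IsModuleAlgebra (Q.twist F) ∧
    -- `H # B` is the crossed product `H ⊗_{R, σ} B`
    IsCrossedProduct D.one (D.smashR Q) (D.smashσ Q) ∧
    D.smashMul Q = crossedMul (D.smashR Q) (D.smashσ Q) ∧
    -- `H_F # _F B` is the crossed product `H ⊗_{R_F, σ_F} B`
    IsCrossedProduct D.one ((D.twist F).smashR (Q.twist F)) ((D.twist F).smashσ (Q.twist F)) ∧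
    (D.twist F).smashMul (Q.twist F) =
      crossedMul ((D.twist F).smashR (Q.twist F)) ((D.twist F).smashσ (Q.twist F)) ∧
    -- `θ` and `γ` satisfy the hypotheses of invariance under twisting, and `R' = R_F`, `σ' = σ_F`
    IsTwistingPair D.one (D.smashR Q) (D.smashσ Q)
      (D.legAct F) (D.legAct (F⁻¹ : (H ⊗[k] H)ˣ)) ∧
    twistedR (D.smashR Q) (D.legAct F) (D.legAct (F⁻¹ : (H ⊗[k] H)ˣ)) =
      (D.twist F).smashR (Q.twist F) ∧
    twistedσ (D.smashR Q) (D.smashσ Q) (D.legAct F) (D.legAct (F⁻¹ : (H ⊗[k] H)ˣ)) =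
      (D.twist F).smashσ (Q.twist F) ∧
    -- both smash products are associative unital algebras, and they are isomorphic
    ∃ (hS : IsAlgebraStructure (D.smashMul Q) ((1 : H) ⊗ₜ[k] D.one))
      (hT : IsAlgebraStructure ((D.twist F).smashMul (Q.twist F)) ((1 : H) ⊗ₜ[k] D.one))
      (e : AlgebraOf hT ≃ₐ[k] AlgebraOf hS),
      (∀ (h : H) (b : B), e (AlgebraOf.of hT (h ⊗ₜ b)) =
        AlgebraOf.of hS ((D.act b).lTensor H ((h ⊗ₜ[k] (1 : H)) * (F : H ⊗[k] H)))) ∧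
      (∀ x : H ⊗[k] B, e (AlgebraOf.of hT x) = AlgebraOf.of hS (ext₁ (D.legAct F) x)) := by
  have hQF := hQ.twist hF
  have hDF := hD.twist hF
  have hX := hD.isCrossedProduct hQ
  have hXF : IsCrossedProduct D.one ((D.twist F).smashR (Q.twist F))
      ((D.twist F).smashσ (Q.twist F)) := hDF.isCrossedProduct hQF
  have hR := hD.twistedR_eq (F := F)
  have hσ := hD.twistedσ_eq (F := F)
  have hθ := hD.isTwistingPair hQ hF
  refine ⟨hQF, hDF, hX, hD.smashMul_eq_crossedMul, hXF, hDF.smashMul_eq_crossedMul, hθ, hR, hσ, ?_⟩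
  rw [hD.smashMul_eq_crossedMul, hDF.smashMul_eq_crossedMul, ← hR, ← hσ]
  rw [← hR, ← hσ] at hXF
  refine ⟨hX.isAlgebraStructure, hXF.isAlgebraStructure, hθ.algEquiv hX _ _, fun h b => ?_,
    hθ.algEquiv_of hX _ _⟩
  rw [hθ.algEquiv_of, D.ext₁_legAct_tmul]
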